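/- Let $d\ge 2$ and equip $[0,1)^d$ with Lebesgue measure $\mathrm{vol}$. For a finite nonempty set $P\subset[0,1)^d$ its isotropic discrepancy is $D_{\mathcal K}(P)=\sup_K\left|\frac{\#(K\cap P)}{\#P}-\mathrm{vol}(K)\right|$, the supremum over all convex sets $K\subseteq[0,1)^d$, and $D_{\mathcal K}(n)=\inf_{\#P=n}D_{\mathcal K}(P)$ is the minimal isotropic discrepancy of $n$-point subsets of $[0,1)^d$. An integration lattice is a set $L=\{\sum_{i=1}^d k_ib_i: k_i\in\mathbb Z\}$ with linearly independent $b_1,\dots,b_d\in\mathbb R^d$ such that $\mathbb Z^d\subseteq L$; it generates the lattice point set $\mathcal P(L)=L\cap[0,1)^d$. Its dual lattice is $L^\perp=\{h\in\mathbb R^d:\langle h,x\rangle\in\mathbb Z\text{ for all }x\in L\}$ and its spectral test is $\sigma(L)=1/\min\{\|h\|_2:h\in L^\perp\setminus\{0\}\}$. 1. For every $d\ge2$ and every integration lattice $L\subset\mathbb R^d$ with $\#\mathcal P(L)=n$, $$\sigma(L)\ge\frac{\sqrt\pi}{2}\,\Gamma\!\left(\tfrac d2+1\right)^{-1/d}\frac1{n^{1/d}}$$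 and $$D_{\mathcal K}(\mathcal P(L))\ge\min\left\{\frac1{2\sqrt d+1},\frac{c_d}{n^{1/d}}\right\},\qquad c_d=\frac{\sqrt\pi}{2\sqrt d+1}\,\Gamma\!\left(\tfrac d2+1\right)^{-1/d}.$$ 2. There is a constant $c>0$, independent of $d$, such that for every $d\ge2$ and every integration lattice $L\subset\mathbb R^d$ with $\#\mathcal P(L)=n$ and $\sigma(L)\le 1/2$, the last bound also holds with $c_d$ replaced by $c_d'=c\,\Gamma\!\left(\tfrac d2+1\right)^{-1/d}$. 3. Consequently, lattice point sets are suboptimal for the isotropic discrepancy: for every $d\ge 2$ and every $C>0$ there is $N$ such that for all $n\ge N$ and all integration lattices $L\subset\mathbb R^d$ with $\#\mathcal P(L)=n$ one has $D_{\mathcal K}(\mathcal P(L))> C\,D_{\mathcal K}(n)$. In particular, Fibonacci lattices do not achieve the optimal rate: with $F_1=F_2=1$, $F_m=F_{m-1}+F_{m-2}$, and $\mathcal F_m=\{(i/F_m,\{iF_{m-1}/F_m\}): 0\le i<F_m\}\subset[0,1)^2$, where $\{\cdot\}$ is the fractional part, for every $C>0$ one has $D_{\mathcal K}(\mathcal F_m)>C\,D_{\mathcal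 K}(F_m)$ (for $d=2$) for all sufficiently large $m$. -/

import Mathlib

open scoped RealInnerProductSpace

/-- The half-open unit cube `[0,1)^d`. -/
def halfOpenCube (d : ℕ) : Set (EuclideanSpace ℝ (Fin d)) :=
  {x | ∀ i, x i ∈ Set.Ico (0 : ℝ) 1}

/-- `L` is a `d`-dimensional lattice, i.e. the set of all integer combinations of `d` linearly
independent vectors of `ℝ^d`, and it contains `ℤ^d`. -/
structure IsIntegrationLattice {d : ℕ} (L : Submodule ℤ (EuclideanSpace ℝ (Fin d))) : Prop where
  exists_basis : ∃ b : Fin d → EuclideanSpace ℝ (Fin d),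
    LinearIndependent ℝ b ∧ L = Submodule.span ℤ (Set.range b)
  int_mem : ∀ x : EuclideanSpace ℝ (Fin d), (∀ i, ∃ k : ℤ, x i = k) → x ∈ L

/-- The point set `P(L) = L ∩ [0,1)^d`. -/
def latticePointSet {d : ℕ} (L : Submodule ℤ (EuclideanSpace ℝ (Fin d))) :
    Set (EuclideanSpace ℝ (Fin d)) :=
  (L : Set (EuclideanSpace ℝ (Fin d))) ∩ halfOpenCube d

/-- The dual lattice of `L`: all vectors having integer inner product with every vector of `L`. -/
noncomputable def dualLattice {d : ℕ} (L : Submodule ℤ (EuclideanSpace ℝ (Fin d))) :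
    Submodule ℤ (EuclideanSpace ℝ (Fin d)) :=
  LinearMap.BilinForm.dualSubmodule (innerₗ (EuclideanSpace ℝ (Fin d))) L

theorem mem_dualLattice {d : ℕ} (L : Submodule ℤ (EuclideanSpace ℝ (Fin d)))
    (h : EuclideanSpace ℝ (Fin d)) :
    h ∈ dualLattice L ↔ ∀ x ∈ L, ∃ k : ℤ, ⟪h, x⟫ = (k : ℝ) := by
  simp only [dualLattice, LinearMap.BilinForm.mem_dualSubmodule, Submodule.mem_one,
    innerₗ_apply_apply, eq_intCast, eq_comm]

/-- The spectral test of `L`: the reciprocal of the Euclidean length of a shortest nonzero vector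
of the dual lattice. -/
noncomputable def spectralTest {d : ℕ} (L : Submodule ℤ (EuclideanSpace ℝ (Fin d))) : ℝ :=
  1 / sInf {r : ℝ | ∃ h ∈ dualLattice L, h ≠ 0 ∧ r = ‖h‖}

/-- The isotropic discrepancy of a finite nonempty point set `P ⊆ [0,1)^d`: the supremum of
`|#(K ∩ P) / #P - vol K|` over all convex sets `K ⊆ [0,1)^d`. -/
noncomputable def isotropicDiscrepancy {d : ℕ} (P : Set (EuclideanSpace ℝ (Fin d))) : ℝ :=
  ⨆ K : {K : Set (EuclideanSpace ℝ (Fin d)) // Convex ℝ K ∧ K ⊆ halfOpenCube d},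
    |((K.1 ∩ P).ncard : ℝ) / (P.ncard : ℝ) - MeasureTheory.volume.real K.1|

/-- The `n`-th minimal isotropic discrepancy: the infimum of the isotropic discrepancy over all
point sets in `[0,1)^d` with exactly `n` points. -/
noncomputable def minimalIsotropicDiscrepancy (d n : ℕ) : ℝ :=
  ⨅ P : {P : Finset (EuclideanSpace ℝ (Fin d)) // P.card = n ∧ ↑P ⊆ halfOpenCube d},
    isotropicDiscrepancy (P.1 : Set (EuclideanSpace ℝ (Fin d)))

/-- The Fibonacci lattice point set `{(i / F_m, {i F_{m-1} / F_m}) : 0 ≤ i < F_m}` in `[0,1)^2`,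
for `m ≥ 1`, where `F_1 = F_2 = 1`. -/
noncomputable def fibonacciPointSet (m : ℕ) : Set (EuclideanSpace ℝ (Fin 2)) :=
  {x | ∃ i : ℕ, i < Nat.fib m ∧
    x = !₂[(i : ℝ) / (Nat.fib m : ℝ),
      Int.fract ((i : ℝ) * (Nat.fib (m - 1) : ℝ) / (Nat.fib m : ℝ))]}

/-! Lower bounds. A nonzero dual vector `h` puts every point of `L` on a hyperplane `⟪h, x⟫ = j`
with `j` an integer. The open slabs between consecutive hyperplanes, cut with the cube, are convex
and contain no point, so each has volume at most the discrepancy `D`. All but a null set of the cube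
is covered by `∑ |h i| ≤ √d ‖h‖` slabs, so `D ≥ 1 / (√d ‖h‖)`. By Chebyshev's inequality, at most `4
‖h‖` slabs already cover three quarters of the cube, so `D ≥ 3 / (16 ‖h‖)` with a constant free of
`d`. Minkowski's theorem for the dual lattice, whose covolume is at most `n`, supplies an `h` of
length `O(n^(1/d))` (`exists_short_dual_vector`).

Suboptimality. It suffices that the minimal discrepancy is `o(n^(-1/d))`
(`exists_minimalIsotropicDiscrepancy_le`). Write `n = k^d + r` with `k^d ≤ n < (k + 1)^d`; draw one
random point in each cell of a `k`-grid and `r` more from the whole cube. For a fixed convex set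
only the `O(k^(d-1))` cells near its boundary and the `r = O(k^(d-1))` extra points contribute
randomness, so by Hoeffding a deviation `θ k^(d-1)` has probability `exp(-c k^(d-1))`.

To treat all convex sets at once, they are bracketed up to volume `O(1/M^2)` by `exp(O(M^(d-1) log
M))` pairs of convex sets (`exists_convex_brackets`). A bracket is indexed by the rounded metric
projections of about `M^(d-1)` points surrounding the cube; their spacing `1/M` controls the body to
precision `1/M^2`. With `M^2` of order `k/θ`, the failure exponent `M^(2(d-1))` beats `M^(d-1) log
M`, and the union bound leaves a discrepancy of order `θ/k` with `θ` arbitrarily small. -/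

open MeasureTheory Module

/-! ### Dual lattices, covolumes and Minkowski's theorem -/

section LatticeGeometry

variable {d : ℕ}

theorem EuclideanSpace.inner_eq_sum_mul (x y : EuclideanSpace ℝ (Fin d)) :
    ⟪x, y⟫ = ∑ i, x i * y i := by
  simp [PiLp.inner_apply, mul_comm]

theorem measurableSet_halfOpenCube : MeasurableSet (halfOpenCube d) := by
  have : halfOpenCube d = ⋂ i, (fun x : EuclideanSpace ℝ (Fin d) => x i) ⁻¹' Set.Ico 0 1 := by
    ext x; simp [halfOpenCube]
  rw [this]
  exact MeasurableSet.iInter fun i => (by fun_prop : Measurable _) measurableSet_Ico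

theorem preimage_toLp_halfOpenCube :
    (WithLp.toLp 2) ⁻¹' (halfOpenCube d) = Set.univ.pi fun _ : Fin d => Set.Ico (0 : ℝ) 1 := by
  ext x; simp [halfOpenCube]

theorem volume_halfOpenCube : volume (halfOpenCube d) = 1 := by
  rw [← (PiLp.volume_preserving_toLp (Fin d)).measure_preimage
    measurableSet_halfOpenCube.nullMeasurableSet, preimage_toLp_halfOpenCube, Real.volume_pi_Ico]
  simp

theorem volume_real_halfOpenCube : volume.real (halfOpenCube d) = 1 := by
  simp [Measure.real, volume_halfOpenCube]

theorem convex_halfOpenCube : Convex ℝ (halfOpenCube d) := by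
  have : halfOpenCube d =
      ⋂ i, (EuclideanSpace.proj i : EuclideanSpace ℝ (Fin d) →L[ℝ] ℝ) ⁻¹' Set.Ico 0 1 := by
    ext x; simp [halfOpenCube]
  rw [this]
  exact convex_iInter fun i => (convex_Ico 0 1).linear_preimage _

/-- The standard basis of Euclidean space, as a plain basis. -/
noncomputable def stdBasis (d : ℕ) : Basis (Fin d) ℝ (EuclideanSpace ℝ (Fin d)) :=
  (EuclideanSpace.basisFun (Fin d) ℝ).toBasis

theorem stdBasis_repr (x : EuclideanSpace ℝ (Fin d)) (i : Fin d) :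
    (stdBasis d).repr x i = x i := by
  simp [stdBasis]

theorem fundamentalDomain_stdBasis : ZSpan.fundamentalDomain (stdBasis d) = halfOpenCube d := by
  ext x
  simp only [ZSpan.mem_fundamentalDomain, stdBasis_repr]
  rfl

theorem mem_span_stdBasis (x : EuclideanSpace ℝ (Fin d)) :
    x ∈ Submodule.span ℤ (Set.range (stdBasis d)) ↔ ∀ i, ∃ k : ℤ, x i = k := by
  rw [(stdBasis d).mem_span_iff_repr_mem ℤ x]
  simp [stdBasis_repr, eq_comm]

theorem innerₗ_nondegenerate :
    LinearMap.BilinForm.Nondegenerate (innerₗ (EuclideanSpace ℝ (Fin d))) := by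
  constructor
  · intro x hx
    exact inner_self_eq_zero.mp (hx x)
  · intro x hx
    exact inner_self_eq_zero.mp (hx x)

/-- The basis dual to `b` with respect to the Euclidean inner product. -/
noncomputable def innerDualBasis (b : Basis (Fin d) ℝ (EuclideanSpace ℝ (Fin d))) :
    Basis (Fin d) ℝ (EuclideanSpace ℝ (Fin d)) :=
  LinearMap.BilinForm.dualBasis (innerₗ (EuclideanSpace ℝ (Fin d))) innerₗ_nondegenerate b

theorem inner_innerDualBasis (b : Basis (Fin d) ℝ (EuclideanSpace ℝ (Fin d))) (i j : Fin d) :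
    ⟪innerDualBasis b i, b j⟫ = if j = i then 1 else 0 :=
  LinearMap.BilinForm.apply_dualBasis_left innerₗ_nondegenerate b i j

theorem dualLattice_span (b : Basis (Fin d) ℝ (EuclideanSpace ℝ (Fin d))) :
    dualLattice (Submodule.span ℤ (Set.range b)) =
      Submodule.span ℤ (Set.range (innerDualBasis b)) :=
  LinearMap.BilinForm.dualSubmodule_span_of_basis (innerₗ _) innerₗ_nondegenerate b

theorem det_innerDualBasis_mul_det (b : Basis (Fin d) ℝ (EuclideanSpace ℝ (Fin d))) :
    (stdBasis d).det (innerDualBasis b) * (stdBasis d).det b = 1 := by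
  rw [Basis.det_apply, Basis.det_apply, ← Matrix.det_transpose, ← Matrix.det_mul]
  convert Matrix.det_one (R := ℝ) (n := Fin d)
  ext i j
  have := inner_innerDualBasis b i j
  rw [EuclideanSpace.inner_eq_sum_mul] at this
  simp [Matrix.mul_apply, Basis.toMatrix_apply, stdBasis_repr, this, Matrix.one_apply, eq_comm]

theorem volume_real_fundamentalDomain_eq (b : Basis (Fin d) ℝ (EuclideanSpace ℝ (Fin d))) :
    volume.real (ZSpan.fundamentalDomain b) = |(stdBasis d).det b| := by
  rw [ZSpan.measureReal_fundamentalDomain b volume (stdBasis d), fundamentalDomain_stdBasis,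
    volume_real_halfOpenCube, mul_one]

/-- Reducing modulo `ℤ^d` moves any lattice vector into the half-open cube, so `P(L)` surjects onto
`L / ℤ^d`. Minkowski needs only this inequality. -/
theorem relIndex_le_encard {L : Submodule ℤ (EuclideanSpace ℝ (Fin d))}
    {n : ℕ} (hn : (latticePointSet L).encard = n)
    (hL : Submodule.span ℤ (Set.range (stdBasis d)) ≤ L) :
    (Submodule.span ℤ (Set.range (stdBasis d))).toAddSubgroup.relIndex L.toAddSubgroup ≤ n := by
  have hfin : (latticePointSet L).Finite := Set.finite_of_encard_eq_coe hn
  have hcard : Nat.card (latticePointSet L) = n := by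
    rw [Nat.card_coe_set_eq, Set.ncard, hn]; rfl
  have := hfin.to_subtype
  rw [← hcard, AddSubgroup.relIndex, AddSubgroup.index]
  refine Nat.card_le_card_of_surjective
    (fun p : latticePointSet L => QuotientAddGroup.mk (⟨p.1, p.2.1⟩ : L.toAddSubgroup)) ?_
  intro q
  obtain ⟨⟨x, hx⟩, rfl⟩ := QuotientAddGroup.mk_surjective q
  have hfl : ((ZSpan.floor (stdBasis d) x : EuclideanSpace ℝ (Fin d))) ∈ L :=
    hL (ZSpan.floor (stdBasis d) x).2
  refine ⟨⟨ZSpan.fract (stdBasis d) x, ?_, ?_⟩, ?_⟩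
  · exact L.sub_mem hx hfl
  · rw [← fundamentalDomain_stdBasis]
    exact ZSpan.fract_mem_fundamentalDomain _ _
  · refine (QuotientAddGroup.eq).2 ?_
    rw [AddSubgroup.mem_addSubgroupOf]
    change -(ZSpan.fract (stdBasis d) x) + x ∈ _
    rw [ZSpan.fract_apply, neg_sub, sub_add_cancel]
    exact (ZSpan.floor (stdBasis d) x).2

theorem IsIntegrationLattice.exists_eq_span {L : Submodule ℤ (EuclideanSpace ℝ (Fin d))}
    (hL : IsIntegrationLattice L) : ∃ b : Basis (Fin d) ℝ (EuclideanSpace ℝ (Fin d)),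
      L = Submodule.span ℤ (Set.range b) := by
  obtain ⟨b, hb, rfl⟩ := hL.exists_basis
  refine ⟨basisOfLinearIndependentOfCardEqFinrank' b hb (by simp), ?_⟩
  rw [coe_basisOfLinearIndependentOfCardEqFinrank']

/-- The covolumes of `L` and its dual are reciprocal, and the covolume of `L` is the reciprocal of
the index of `ℤ^d` in `L`. -/
theorem abs_det_innerDualBasis_le {b : Basis (Fin d) ℝ (EuclideanSpace ℝ (Fin d))}
    (hL : IsIntegrationLattice (Submodule.span ℤ (Set.range b))) {n : ℕ}
    (hn : (latticePointSet (Submodule.span ℤ (Set.range b))).encard = n) :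
    |(stdBasis d).det (innerDualBasis b)| ≤ n := by
  have hle : Submodule.span ℤ (Set.range (stdBasis d)) ≤ Submodule.span ℤ (Set.range b) :=
    fun x hx => hL.int_mem x ((mem_span_stdBasis x).1 hx)
  have h := ZLattice.covolume_div_covolume_eq_relIndex' _ _ hle
  rw [ZLattice.covolume_eq_measure_fundamentalDomain _ _
      (ZSpan.isAddFundamentalDomain (stdBasis d) volume),
    ZLattice.covolume_eq_measure_fundamentalDomain _ _ (ZSpan.isAddFundamentalDomain b volume),
    fundamentalDomain_stdBasis, volume_real_halfOpenCube, volume_real_fundamentalDomain_eq] at h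
  have h1 := congrArg abs (det_innerDualBasis_mul_det b)
  rw [abs_mul, abs_one] at h1
  rw [eq_one_div_of_mul_eq_one_left h1, h]
  exact_mod_cast relIndex_le_encard hn hle

theorem exists_int_of_mem_dualLattice {L : Submodule ℤ (EuclideanSpace ℝ (Fin d))}
    (hL : IsIntegrationLattice L) {h : EuclideanSpace ℝ (Fin d)} (hh : h ∈ dualLattice L)
    (i : Fin d) : ∃ k : ℤ, h i = k := by
  have hmem : EuclideanSpace.single i (1 : ℝ) ∈ L := by
    refine hL.int_mem _ fun j => ?_
    by_cases hij : j = i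
    · exact ⟨1, by simp [hij]⟩
    · exact ⟨0, by simp [hij]⟩
  obtain ⟨k, hk⟩ := (mem_dualLattice L h).1 hh _ hmem
  exact ⟨k, by simpa [EuclideanSpace.inner_single_right] using hk⟩

theorem one_le_norm_of_int {h : EuclideanSpace ℝ (Fin d)} (hint : ∀ i, ∃ k : ℤ, h i = k)
    (h0 : h ≠ 0) : 1 ≤ ‖h‖ := by
  obtain ⟨i, hi⟩ : ∃ i, h i ≠ 0 := by
    by_contra hcon
    push Not at hcon
    exact h0 (by ext i; simpa using hcon i)
  obtain ⟨k, hk⟩ := hint i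
  have hk0 : k ≠ 0 := by
    rintro rfl
    exact hi (by simpa using hk)
  calc (1 : ℝ) ≤ |(k : ℝ)| := by exact_mod_cast Int.one_le_abs hk0
    _ = ‖h i‖ := by rw [hk, Real.norm_eq_abs]
    _ ≤ ‖h‖ := PiLp.norm_apply_le h i

/-- The bound for a shortest dual vector coming from Minkowski's convex body theorem. -/
theorem exists_short_dual_vector (hd : 2 ≤ d) {L : Submodule ℤ (EuclideanSpace ℝ (Fin d))}
    (hL : IsIntegrationLattice L) {n : ℕ} (hn : (latticePointSet L).encard = n) :
    ∃ h ∈ dualLattice L, h ≠ 0 ∧ ‖h‖ ≤ 2 / Real.sqrt Real.pi *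
      Real.Gamma ((d : ℝ) / 2 + 1) ^ (1 / (d : ℝ)) * (n : ℝ) ^ (1 / (d : ℝ)) := by
  obtain ⟨b, rfl⟩ := hL.exists_eq_span
  have hd0 : (0 : ℝ) < d := by positivity
  have : Nonempty (Fin d) := ⟨⟨0, by omega⟩⟩
  have hdet := abs_det_innerDualBasis_le hL hn
  set G := Real.Gamma ((d : ℝ) / 2 + 1) with hG
  have hGpos : 0 < G := Real.Gamma_pos_of_pos (by positivity)
  -- The radius at which the ball has volume exactly `2 ^ d * n`. Equality suffices in Minkowski's
  -- theorem because the closed ball is compact.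
  set r : ℝ := 2 / Real.sqrt Real.pi * G ^ (1 / (d : ℝ)) * (n : ℝ) ^ (1 / (d : ℝ)) with hr
  have hr0 : 0 ≤ r := by positivity
  have hpi : 0 < Real.sqrt Real.pi := Real.sqrt_pos.2 Real.pi_pos
  have key : r ^ d * (Real.sqrt Real.pi ^ d / G) = n * 2 ^ d := by
    rw [hr, mul_pow, mul_pow, div_pow, ← Real.rpow_natCast (G ^ _), ← Real.rpow_mul hGpos.le,
      ← Real.rpow_natCast ((n : ℝ) ^ _), ← Real.rpow_mul (by positivity),
      one_div_mul_cancel hd0.ne', Real.rpow_one, Real.rpow_one]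
    field_simp
  have : DiscreteTopology (Submodule.span ℤ (Set.range (innerDualBasis b))).toAddSubgroup :=
    inferInstanceAs (DiscreteTopology (Submodule.span ℤ (Set.range (innerDualBasis b))))
  have : Countable (Submodule.span ℤ (Set.range (innerDualBasis b))).toAddSubgroup :=
    inferInstanceAs (Countable (Submodule.span ℤ (Set.range (innerDualBasis b))))
  obtain ⟨x, hx0, hx⟩ := exists_ne_zero_mem_lattice_of_measure_mul_two_pow_le_measure
    (ZSpan.isAddFundamentalDomain' (innerDualBasis b) volume)
    (s := Metric.closedBall (0 : EuclideanSpace ℝ (Fin d)) r) (by simp)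
    (convex_closedBall 0 r) (isCompact_closedBall 0 r) (by
      rw [EuclideanSpace.volume_closedBall, finrank_euclideanSpace_fin, Fintype.card_fin, ← hG,
        ← ENNReal.ofReal_pow hr0, ← ENNReal.ofReal_mul (by positivity), key,
        ENNReal.ofReal_mul (by positivity), ENNReal.ofReal_pow (by norm_num),
        ENNReal.ofReal_ofNat]
      gcongr
      rw [← ENNReal.ofReal_toReal
        ((ZSpan.fundamentalDomain_isBounded (innerDualBasis b)).measure_lt_top.ne)]
      refine ENNReal.ofReal_le_ofReal ?_
      rw [← Measure.real, volume_real_fundamentalDomain_eq]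
      exact hdet)
  refine ⟨x, ?_, fun h => hx0 (Subtype.ext h), by simpa using hx⟩
  rw [dualLattice_span]
  exact x.2

/-- Since `ℤ^d ⊆ L`, dual vectors are integral and the infimum of their lengths is at least `1`;
this positivity is what permits taking reciprocals. -/
theorem one_div_norm_le_spectralTest {L : Submodule ℤ (EuclideanSpace ℝ (Fin d))}
    (hL : IsIntegrationLattice L) {h : EuclideanSpace ℝ (Fin d)} (hh : h ∈ dualLattice L)
    (h0 : h ≠ 0) : 1 / ‖h‖ ≤ spectralTest L := by
  have hlow : ∀ r ∈ {r : ℝ | ∃ h ∈ dualLattice L, h ≠ 0 ∧ r = ‖h‖}, 1 ≤ r := by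
    rintro r ⟨g, hg, hg0, rfl⟩
    exact one_le_norm_of_int (exists_int_of_mem_dualLattice hL hg) hg0
  have hmem : ‖h‖ ∈ {r : ℝ | ∃ h ∈ dualLattice L, h ≠ 0 ∧ r = ‖h‖} := ⟨h, hh, h0, rfl⟩
  unfold spectralTest
  refine one_div_le_one_div_of_le (lt_of_lt_of_le one_pos (le_csInf ⟨_, hmem⟩ hlow)) ?_
  exact csInf_le ⟨1, hlow⟩ hmem

end LatticeGeometry

/-! ### Lower bounds from empty slabs -/

section DiscrepancyLowerBounds

variable {d : ℕ}

theorem ncard_inter_div_mem_Icc {P : Set (EuclideanSpace ℝ (Fin d))} (hP : P.Finite)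
    (K : Set (EuclideanSpace ℝ (Fin d))) :
    ((K ∩ P).ncard : ℝ) / (P.ncard : ℝ) ∈ Set.Icc (0 : ℝ) 1 := by
  refine ⟨by positivity, div_le_one_of_le₀ ?_ (by positivity)⟩
  exact_mod_cast Set.ncard_le_ncard Set.inter_subset_right hP

theorem volume_real_le_one_of_subset {K : Set (EuclideanSpace ℝ (Fin d))}
    (hK : K ⊆ halfOpenCube d) : volume.real K ≤ 1 := by
  rw [← volume_real_halfOpenCube (d := d)]
  exact measureReal_mono hK (by simp [volume_halfOpenCube])

/-- An unbounded real supremum would take the default value `0`, so boundedness is needed before any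
single `K` gives a lower bound. -/
theorem bddAbove_discrepancy {P : Set (EuclideanSpace ℝ (Fin d))} (hP : P.Finite) :
    BddAbove (Set.range fun K : {K : Set (EuclideanSpace ℝ (Fin d)) //
      Convex ℝ K ∧ K ⊆ halfOpenCube d} =>
      |((K.1 ∩ P).ncard : ℝ) / (P.ncard : ℝ) - volume.real K.1|) := by
  refine ⟨1, ?_⟩
  rintro _ ⟨⟨K, hK, hKc⟩, rfl⟩
  have h1 := ncard_inter_div_mem_Icc hP K
  have h2 := volume_real_le_one_of_subset hKc
  have h3 : 0 ≤ volume.real K := measureReal_nonneg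
  simp only [abs_le]
  constructor <;> linarith [h1.1, h1.2]

theorem le_isotropicDiscrepancy {P : Set (EuclideanSpace ℝ (Fin d))} (hP : P.Finite)
    {K : Set (EuclideanSpace ℝ (Fin d))} (hK : Convex ℝ K) (hKc : K ⊆ halfOpenCube d) :
    |((K ∩ P).ncard : ℝ) / (P.ncard : ℝ) - volume.real K| ≤ isotropicDiscrepancy P :=
  le_ciSup (bddAbove_discrepancy hP) ⟨K, hK, hKc⟩

theorem isotropicDiscrepancy_nonneg (P : Set (EuclideanSpace ℝ (Fin d))) :
    0 ≤ isotropicDiscrepancy P :=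
  Real.iSup_nonneg fun _ => abs_nonneg _

theorem volume_hyperplane {h : EuclideanSpace ℝ (Fin d)} (h0 : h ≠ 0) (c : ℝ) :
    volume {x : EuclideanSpace ℝ (Fin d) | ⟪h, x⟫ = c} = 0 := by
  let s : AffineSubspace ℝ (EuclideanSpace ℝ (Fin d)) :=
    { carrier := {x | ⟪h, x⟫ = c}
      smul_vsub_vadd_mem' := by
        intro t x y z hx hy hz
        simp only [Set.mem_ofPred_eq] at hx hy hz ⊢
        rw [vadd_eq_add, vsub_eq_sub, inner_add_right, inner_smul_right, inner_sub_right, hx, hy,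
          hz]
        ring }
  refine Measure.addHaar_affineSubspace volume s fun hs => ?_
  have hall : ∀ x : EuclideanSpace ℝ (Fin d), ⟪h, x⟫ = c := fun x =>
    (hs ▸ AffineSubspace.mem_top ℝ _ x : x ∈ s)
  have h1 := hall h
  rw [← hall 0, inner_zero_right] at h1
  exact h0 (inner_self_eq_zero.1 h1)

/-- The open slab is convex and misses the lattice. Adding its null lower face gives the half-open
slabs, which are the level sets of the floor and partition the cube. -/
theorem volume_real_slab_le {L : Submodule ℤ (EuclideanSpace ℝ (Fin d))}
    (hP : (latticePointSet L).Finite) {h : EuclideanSpace ℝ (Fin d)} (hh : h ∈ dualLattice L)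
    (h0 : h ≠ 0) (j : ℤ) :
    volume.real {x ∈ halfOpenCube d | ⌊⟪h, x⟫⌋ = j} ≤
      isotropicDiscrepancy (latticePointSet L) := by
  set S : Set (EuclideanSpace ℝ (Fin d)) :=
    halfOpenCube d ∩ (innerₗ (EuclideanSpace ℝ (Fin d)) h) ⁻¹' (Set.Ioo (j : ℝ) (j + 1)) with hS
  have hconv : Convex ℝ S := convex_halfOpenCube.inter ((convex_Ioo _ _).linear_preimage _)
  have hempty : S ∩ latticePointSet L = ∅ := by
    rw [Set.eq_empty_iff_forall_notMem]
    rintro x ⟨⟨-, hx⟩, hxL, -⟩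
    obtain ⟨k, hk⟩ := (mem_dualLattice L h).1 hh x hxL
    simp only [Set.mem_preimage, innerₗ_apply_apply, hk, Set.mem_Ioo] at hx
    have h1 : j < k := by exact_mod_cast hx.1
    have h2 : k < j + 1 := by exact_mod_cast hx.2
    omega
  have key := le_isotropicDiscrepancy hP hconv Set.inter_subset_left
  rw [hempty, Set.ncard_empty, Nat.cast_zero, zero_div, zero_sub, abs_neg,
    abs_of_nonneg measureReal_nonneg] at key
  have hsub : {x ∈ halfOpenCube d | ⌊⟪h, x⟫⌋ = j} ⊆ S ∪ {x | ⟪h, x⟫ = (j : ℝ)} := by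
    rintro x ⟨hx, hj⟩
    rw [Int.floor_eq_iff] at hj
    rcases hj.1.eq_or_lt with he | hlt
    · exact Or.inr he.symm
    · exact Or.inl ⟨hx, hlt, hj.2⟩
  calc volume.real {x ∈ halfOpenCube d | ⌊⟪h, x⟫⌋ = j}
      ≤ volume.real (S ∪ {x | ⟪h, x⟫ = (j : ℝ)}) := by
        refine measureReal_mono hsub ?_
        refine (measure_union_lt_top ?_ ?_).ne
        · exact lt_of_le_of_lt (measure_mono Set.inter_subset_left)
            (by simp [volume_halfOpenCube])
        · simp [volume_hyperplane h0]
    _ ≤ volume.real S + volume.real {x | ⟪h, x⟫ = (j : ℝ)} := measureReal_union_le _ _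
    _ = volume.real S := by simp [Measure.real, volume_hyperplane h0]
    _ ≤ _ := key

theorem volume_real_slabs_le {L : Submodule ℤ (EuclideanSpace ℝ (Fin d))}
    (hP : (latticePointSet L).Finite) {h : EuclideanSpace ℝ (Fin d)} (hh : h ∈ dualLattice L)
    (h0 : h ≠ 0) (I : Finset ℤ) :
    volume.real {x ∈ halfOpenCube d | ⌊⟪h, x⟫⌋ ∈ I} ≤
      I.card * isotropicDiscrepancy (latticePointSet L) := by
  have : {x ∈ halfOpenCube d | ⌊⟪h, x⟫⌋ ∈ I} =
      ⋃ j ∈ I, {x ∈ halfOpenCube d | ⌊⟪h, x⟫⌋ = j} := by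
    ext x; simp
  rw [this, ← nsmul_eq_mul]
  exact (measureReal_biUnion_finset_le _ _).trans
    (Finset.sum_le_card_nsmul _ _ _ fun j _ => volume_real_slab_le hP hh h0 j)

theorem one_le_sqrt_mul_norm_mul_isotropicDiscrepancy
    {L : Submodule ℤ (EuclideanSpace ℝ (Fin d))} (hL : IsIntegrationLattice L)
    (hP : (latticePointSet L).Finite) {h : EuclideanSpace ℝ (Fin d)} (hh : h ∈ dualLattice L)
    (h0 : h ≠ 0) :
    1 ≤ Real.sqrt d * ‖h‖ * isotropicDiscrepancy (latticePointSet L) := by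
  choose k hk using exists_int_of_mem_dualLattice hL hh
  -- `a` and `b` are the minimum and maximum of `⟪h, x⟫` over the closed cube; their difference is
  -- the `ℓ¹` norm of `h`, and Cauchy-Schwarz brings in `√d`.
  set a : ℤ := ∑ i, min (k i) 0 with ha
  set b : ℤ := ∑ i, max (k i) 0 with hb
  have hba : b - a = ∑ i, |k i| := by
    rw [ha, hb, ← Finset.sum_sub_distrib]
    exact Finset.sum_congr rfl fun i _ => by simp [max_sub_min_eq_abs']
  have hl1 : ((Finset.Ico a b).card : ℝ) ≤ Real.sqrt d * ‖h‖ := by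
    have h1 : ((Finset.Ico a b).card : ℤ) = b - a := by
      rw [Int.card_Ico, Int.toNat_of_nonneg]
      rw [hba]
      positivity
    have h2 : ((Finset.Ico a b).card : ℝ) = ∑ i, |h i| := by
      have : ((Finset.Ico a b).card : ℝ) = ((b - a : ℤ) : ℝ) := by exact_mod_cast h1
      rw [this, hba]
      simp [hk]
    rw [h2, EuclideanSpace.norm_eq, ← Real.sqrt_mul (by positivity)]
    refine Real.le_sqrt_of_sq_le ?_
    simpa using sq_sum_le_card_mul_sum_sq (s := Finset.univ) (f := fun i => |h i|)
  -- The value `b` itself may be attained, but only on a null hyperplane, so no slab with index `b`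
  -- is needed.
  have hset : {x ∈ halfOpenCube d | ⌊⟪h, x⟫⌋ ∈ Finset.Ico a b} =ᵐ[volume] halfOpenCube d := by
    have hne : ∀ᵐ x ∂(volume : Measure (EuclideanSpace ℝ (Fin d))), ⟪h, x⟫ ≠ (b : ℝ) := by
      rw [ae_iff]
      simpa using volume_hyperplane h0 b
    filter_upwards [hne] with x hx
    refine propext ⟨fun hx' => hx'.1, fun hxc => ⟨hxc, ?_⟩⟩
    have hsum : ⟪h, x⟫ = ∑ i, (k i : ℝ) * x i := by
      rw [EuclideanSpace.inner_eq_sum_mul]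
      exact Finset.sum_congr rfl fun i _ => by rw [hk]
    have hge : (a : ℝ) ≤ ⟪h, x⟫ := by
      rw [hsum, ha]
      push_cast
      refine Finset.sum_le_sum fun i _ => ?_
      rcases le_total (k i : ℝ) 0 with h' | h'
      · rw [min_eq_left h']; nlinarith [(hxc i).2]
      · rw [min_eq_right h']; exact mul_nonneg h' (hxc i).1
    have hle : ⟪h, x⟫ ≤ (b : ℝ) := by
      rw [hsum, hb]
      push_cast
      refine Finset.sum_le_sum fun i _ => ?_
      rcases le_total (k i : ℝ) 0 with h' | h'
      · rw [max_eq_right h']; nlinarith [(hxc i).1]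
      · rw [max_eq_left h']; nlinarith [(hxc i).2]
    rw [Finset.mem_Ico]
    exact ⟨Int.le_floor.2 hge, Int.floor_lt.2 (lt_of_le_of_ne hle hx)⟩
  have key := volume_real_slabs_le hP hh h0 (Finset.Ico a b)
  rw [measureReal_congr hset, volume_real_halfOpenCube] at key
  exact key.trans (by gcongr; exact isotropicDiscrepancy_nonneg _)

/-- For uniform `x` the terms `h i * x i` are independent with range of length `|h i|`, hence
variance at most `(h i)^2 / 4`. The sum has variance at most `‖h‖^2 / 4`, and Chebyshev at distance
`‖h‖` loses at most a quarter of the mass. -/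
theorem exists_center_volume_real_ge {h : EuclideanSpace ℝ (Fin d)} (h0 : h ≠ 0) :
    ∃ c : ℝ, 3 / 4 ≤ volume.real {x ∈ halfOpenCube d | |⟪h, x⟫ - c| < ‖h‖} := by
  have : IsProbabilityMeasure ((volume : Measure ℝ).restrict (Set.Ico 0 1)) := ⟨by simp⟩
  set μ : Measure (Fin d → ℝ) :=
    Measure.pi fun _ : Fin d => (volume : Measure ℝ).restrict (Set.Ico 0 1) with hμ
  have hμr : μ = volume.restrict (Set.univ.pi fun _ : Fin d => Set.Ico (0 : ℝ) 1) := by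
    rw [hμ, volume_pi, Measure.restrict_pi_pi]
  have hIcc : ∀ i, ∀ᵐ t ∂((volume : Measure ℝ).restrict (Set.Ico 0 1)),
      h i * t ∈ Set.Icc (min (h i) 0) (max (h i) 0) := fun i => by
    filter_upwards [ae_restrict_mem measurableSet_Ico] with t ht
    rcases le_total (h i) 0 with h' | h'
    · rw [min_eq_left h', max_eq_right h']
      constructor <;> nlinarith [ht.1, ht.2]
    · rw [min_eq_right h', max_eq_left h']
      constructor <;> nlinarith [ht.1, ht.2]
  have hmeas : ∀ i, Measurable fun t : ℝ => h i * t := fun i => by fun_prop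
  have hLp : ∀ i, MemLp (fun t : ℝ => h i * t) 2 ((volume : Measure ℝ).restrict (Set.Ico 0 1)) :=
    fun i => memLp_of_bounded (hIcc i) (hmeas i).aestronglyMeasurable 2
  set X : (Fin d → ℝ) → ℝ := ∑ i, fun ω => h i * ω i with hX
  have hXLp : MemLp X 2 μ := by
    rw [hX]
    exact memLp_finsetSum' _ fun i _ => (hLp i).comp_measurePreserving
      (measurePreserving_eval (fun _ : Fin d => (volume : Measure ℝ).restrict (Set.Ico 0 1)) i)
  have hvar : ProbabilityTheory.variance X μ ≤ ‖h‖ ^ 2 / 4 := by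
    rw [hX, hμ, ProbabilityTheory.variance_sum_pi (X := fun i t => h i * t) hLp,
      EuclideanSpace.norm_sq_eq, Finset.sum_div]
    refine Finset.sum_le_sum fun i _ => ?_
    refine (ProbabilityTheory.variance_le_sq_of_bounded (hIcc i) (hmeas i).aemeasurable).trans ?_
    rw [max_sub_min_eq_abs', div_pow, sub_zero, Real.norm_eq_abs]
    norm_num
  have hpos : 0 < ‖h‖ := norm_pos_iff.2 h0
  have hcheb := ProbabilityTheory.meas_ge_le_variance_div_sq hXLp hpos
  set c := ∫ ω, X ω ∂μ with hc
  refine ⟨c, ?_⟩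
  set T : Set (Fin d → ℝ) := {ω | ‖h‖ ≤ |X ω - c|} with hT
  have hXm : Measurable X := by rw [hX]; fun_prop
  have hTm : MeasurableSet T := measurableSet_le measurable_const
    (by fun_prop : Measurable fun ω => |X ω - c|)
  have hTle : μ.real T ≤ 1 / 4 := by
    refine ENNReal.toReal_le_of_le_ofReal (by norm_num) (hcheb.trans ?_)
    refine ENNReal.ofReal_le_ofReal ?_
    rw [div_le_iff₀ (by positivity)]
    linarith
  have hcompl : μ.real Tᶜ = 1 - μ.real T := by
    rw [measureReal_compl hTm, probReal_univ]
  have hset : MeasurableSet {x ∈ halfOpenCube d | |⟪h, x⟫ - c| < ‖h‖} :=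
    measurableSet_halfOpenCube.inter (measurableSet_lt
      (by fun_prop : Measurable fun x : EuclideanSpace ℝ (Fin d) => |⟪h, x⟫ - c|) measurable_const)
  have heq : volume.real {x ∈ halfOpenCube d | |⟪h, x⟫ - c| < ‖h‖} = μ.real Tᶜ := by
    rw [← (PiLp.volume_preserving_toLp (Fin d)).measureReal_preimage hset.nullMeasurableSet, hμr,
      measureReal_restrict_apply hTm.compl]
    congr 1
    ext ω
    have h1 := Set.ext_iff.1 (preimage_toLp_halfOpenCube (d := d)) ω
    simp only [Set.mem_preimage] at h1
    simp only [Set.mem_preimage, Set.mem_ofPred_eq, h1, EuclideanSpace.inner_eq_sum_mul, hT, hX,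
      Set.mem_inter_iff, Set.mem_compl_iff, not_le, Finset.sum_apply]
    tauto
  rw [heq, hcompl]
  linarith

theorem le_norm_mul_isotropicDiscrepancy
    {L : Submodule ℤ (EuclideanSpace ℝ (Fin d))} (hL : IsIntegrationLattice L)
    (hP : (latticePointSet L).Finite) {h : EuclideanSpace ℝ (Fin d)} (hh : h ∈ dualLattice L)
    (h0 : h ≠ 0) :
    3 / 16 ≤ ‖h‖ * isotropicDiscrepancy (latticePointSet L) := by
  obtain ⟨c, hc⟩ := exists_center_volume_real_ge h0
  have h1 := one_le_norm_of_int (exists_int_of_mem_dualLattice hL hh) h0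
  set I := Finset.Icc ⌊c - ‖h‖⌋ ⌊c + ‖h‖⌋ with hI
  -- An interval of length `2 ‖h‖` meets at most `2 ‖h‖ + 2` unit slabs, and integrality gives `‖h‖
  -- ≥ 1`.
  have hcard : (I.card : ℝ) ≤ 4 * ‖h‖ := by
    have h2 : (I.card : ℤ) = ⌊c + ‖h‖⌋ + 1 - ⌊c - ‖h‖⌋ := by
      rw [hI, Int.card_Icc, Int.toNat_of_nonneg]
      have : ⌊c - ‖h‖⌋ ≤ ⌊c + ‖h‖⌋ := Int.floor_le_floor (by linarith)
      omega
    have h3 : (I.card : ℝ) = ⌊c + ‖h‖⌋ + 1 - ⌊c - ‖h‖⌋ := by exact_mod_cast h2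
    rw [h3]
    linarith [Int.floor_le (c + ‖h‖), Int.lt_floor_add_one (c - ‖h‖)]
  have hsub : {x ∈ halfOpenCube d | |⟪h, x⟫ - c| < ‖h‖} ⊆
      {x ∈ halfOpenCube d | ⌊⟪h, x⟫⌋ ∈ I} := by
    rintro x ⟨hx, hxc⟩
    refine ⟨hx, Finset.mem_Icc.2 ?_⟩
    rw [abs_lt] at hxc
    exact ⟨Int.floor_le_floor (by linarith), Int.floor_le_floor (by linarith)⟩
  have h4 : volume.real {x ∈ halfOpenCube d | |⟪h, x⟫ - c| < ‖h‖} ≤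
      volume.real {x ∈ halfOpenCube d | ⌊⟪h, x⟫⌋ ∈ I} :=
    measureReal_mono hsub (lt_of_le_of_lt (measure_mono (Set.sep_subset _ _))
      (by simp [volume_halfOpenCube])).ne
  have h5 := volume_real_slabs_le hP hh h0 I
  have h6 : (I.card : ℝ) * isotropicDiscrepancy (latticePointSet L) ≤
      4 * ‖h‖ * isotropicDiscrepancy (latticePointSet L) := by
    gcongr
    exact isotropicDiscrepancy_nonneg _
  linarith

theorem spectralTest_lower_bound (hd : 2 ≤ d) {L : Submodule ℤ (EuclideanSpace ℝ (Fin d))}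
    (hL : IsIntegrationLattice L) {n : ℕ} (hn : (latticePointSet L).encard = n) :
    Real.sqrt Real.pi / 2 * Real.Gamma ((d : ℝ) / 2 + 1) ^ (-(1 / (d : ℝ)))
      * (1 / (n : ℝ) ^ (1 / (d : ℝ))) ≤ spectralTest L := by
  obtain ⟨h, hh, h0, hle⟩ := exists_short_dual_vector hd hL hn
  refine le_trans ?_ (one_div_norm_le_spectralTest hL hh h0)
  have hG : 0 < Real.Gamma ((d : ℝ) / 2 + 1) := Real.Gamma_pos_of_pos (by positivity)
  calc _ = 1 / (2 / Real.sqrt Real.pi * Real.Gamma ((d : ℝ) / 2 + 1) ^ (1 / (d : ℝ)) *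
        (n : ℝ) ^ (1 / (d : ℝ))) := by
        rw [Real.rpow_neg hG.le]
        field_simp
    _ ≤ _ := one_div_le_one_div_of_le (norm_pos_iff.2 h0) hle

/-- Here `s` is the reciprocal length of the Minkowski vector, which need not be a shortest one;
both discrepancy bounds hold for any nonzero dual vector. -/
theorem exists_norm_and_isotropicDiscrepancy_bounds (hd : 2 ≤ d)
    {L : Submodule ℤ (EuclideanSpace ℝ (Fin d))}
    (hL : IsIntegrationLattice L) {n : ℕ} (hn : (latticePointSet L).encard = n) :
    ∃ s : ℝ, 0 < s ∧ Real.sqrt Real.pi / 2 * Real.Gamma ((d : ℝ) / 2 + 1) ^ (-(1 / (d : ℝ)))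
      * (1 / (n : ℝ) ^ (1 / (d : ℝ))) ≤ s ∧
      s ≤ Real.sqrt d * isotropicDiscrepancy (latticePointSet L) ∧
      3 / 16 * s ≤ isotropicDiscrepancy (latticePointSet L) := by
  obtain ⟨h, hh, h0, hle⟩ := exists_short_dual_vector hd hL hn
  have hP : (latticePointSet L).Finite := Set.finite_of_encard_eq_coe hn
  have hpos : 0 < ‖h‖ := norm_pos_iff.2 h0
  have hG : 0 < Real.Gamma ((d : ℝ) / 2 + 1) := Real.Gamma_pos_of_pos (by positivity)
  refine ⟨1 / ‖h‖, by positivity, ?_, ?_, ?_⟩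
  · calc _ = 1 / (2 / Real.sqrt Real.pi * Real.Gamma ((d : ℝ) / 2 + 1) ^ (1 / (d : ℝ)) *
          (n : ℝ) ^ (1 / (d : ℝ))) := by
          rw [Real.rpow_neg hG.le]
          field_simp
      _ ≤ _ := one_div_le_one_div_of_le hpos hle
  · rw [div_le_iff₀ hpos]
    linarith [one_le_sqrt_mul_norm_mul_isotropicDiscrepancy hL hP hh h0]
  · rw [mul_one_div, div_le_iff₀ hpos]
    linarith [le_norm_mul_isotropicDiscrepancy hL hP hh h0]

theorem isotropicDiscrepancy_lower_bound (hd : 2 ≤ d)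
    {L : Submodule ℤ (EuclideanSpace ℝ (Fin d))}
    (hL : IsIntegrationLattice L) {n : ℕ} (hn : (latticePointSet L).encard = n) :
    (Real.sqrt Real.pi / (2 * Real.sqrt (d : ℝ) + 1)
        * Real.Gamma ((d : ℝ) / 2 + 1) ^ (-(1 / (d : ℝ)))) / (n : ℝ) ^ (1 / (d : ℝ))
      ≤ isotropicDiscrepancy (latticePointSet L) := by
  obtain ⟨s, hs, hle, hD, -⟩ := exists_norm_and_isotropicDiscrepancy_bounds hd hL hn
  have hG : 0 < Real.Gamma ((d : ℝ) / 2 + 1) := Real.Gamma_pos_of_pos (by positivity)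
  have h1 := isotropicDiscrepancy_nonneg (latticePointSet L)
  calc _ = 2 / (2 * Real.sqrt (d : ℝ) + 1) * (Real.sqrt Real.pi / 2 *
        Real.Gamma ((d : ℝ) / 2 + 1) ^ (-(1 / (d : ℝ))) * (1 / (n : ℝ) ^ (1 / (d : ℝ)))) := by
        ring
    _ ≤ 2 / (2 * Real.sqrt (d : ℝ) + 1) *
        (Real.sqrt d * isotropicDiscrepancy (latticePointSet L)) := by
        exact mul_le_mul_of_nonneg_left (hle.trans hD) (by positivity)
    _ ≤ _ := by
        rw [div_mul_eq_mul_div, div_le_iff₀ (by positivity)]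
        nlinarith

theorem isotropicDiscrepancy_lower_bound_uniform (hd : 2 ≤ d)
    {L : Submodule ℤ (EuclideanSpace ℝ (Fin d))}
    (hL : IsIntegrationLattice L) {n : ℕ} (hn : (latticePointSet L).encard = n) :
    (3 / 32 * Real.sqrt Real.pi * Real.Gamma ((d : ℝ) / 2 + 1) ^ (-(1 / (d : ℝ))))
        / (n : ℝ) ^ (1 / (d : ℝ))
      ≤ isotropicDiscrepancy (latticePointSet L) := by
  obtain ⟨s, hs, hle, -, hD⟩ := exists_norm_and_isotropicDiscrepancy_bounds hd hL hn
  refine le_trans ?_ hD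
  calc _ = 3 / 16 * (Real.sqrt Real.pi / 2 *
        Real.Gamma ((d : ℝ) / 2 + 1) ^ (-(1 / (d : ℝ))) * (1 / (n : ℝ) ^ (1 / (d : ℝ)))) := by
        ring
    _ ≤ _ := by gcongr

end DiscrepancyLowerBounds

/-! ### Grid cells near the boundary of a convex set -/

section ConvexCells

variable {d : ℕ}

theorem exists_projection {K : Set (EuclideanSpace ℝ (Fin d))} (hne : K.Nonempty)
    (hcl : IsClosed K) (hK : Convex ℝ K) (q : EuclideanSpace ℝ (Fin d)) :
    ∃ p ∈ K, ∀ w ∈ K, ⟪q - p, w - p⟫ ≤ 0 := by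
  obtain ⟨p, hp, hpq⟩ := exists_norm_eq_iInf_of_complete_convex hne hcl.isComplete hK q
  exact ⟨p, hp, (norm_eq_iInf_iff_real_inner_le_zero hK hp).1 hpq⟩

/-- The cell with index `a` of the grid of mesh `1 / m` on the unit cube. -/
def gridCell (m : ℕ) (a : Fin d → Fin m) : Set (EuclideanSpace ℝ (Fin d)) :=
  {x | ∀ i, (a i : ℝ) ≤ m * x i ∧ m * x i < a i + 1}

/-- `x` and `y` differ by at most `ρ / m` in each coordinate. -/
def GridNear (m ρ : ℕ) (x y : EuclideanSpace ℝ (Fin d)) : Prop :=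
  ∀ j, |(m : ℝ) * x j - m * y j| ≤ ρ

/-- The grid cell with index `a` comes close to the boundary of `K`. -/
def NearBoundary (m ρ : ℕ) (K : Set (EuclideanSpace ℝ (Fin d))) (a : Fin d → Fin m) : Prop :=
  ∃ x ∈ gridCell m a, (∃ k ∈ K, GridNear m ρ x k) ∧ ∃ y ∉ K, GridNear m ρ x y

/-- The grid cell with index `a` comes close to a supporting hyperplane of `K` whose normal has
`s • e i` as its dominant direction. -/
def NearFace (m ρ : ℕ) (K : Set (EuclideanSpace ℝ (Fin d))) (i : Fin d) (s : ℝ)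
    (a : Fin d → Fin m) : Prop :=
  ∃ x ∈ gridCell m a, (∃ k ∈ K, GridNear m ρ x k) ∧ ∃ y, GridNear m ρ x y ∧
    ∃ u : EuclideanSpace ℝ (Fin d), (∀ w ∈ K, ⟪w, u⟫ ≤ ⟪y, u⟫) ∧ 0 < s * u i ∧
      ∀ j, |u j| ≤ s * u i

/-- The outside point minus its projection onto `K` is an outer normal; its coordinate of largest
modulus gives the axis and the sign. -/
theorem NearBoundary.exists_nearFace {m ρ : ℕ} {K : Set (EuclideanSpace ℝ (Fin d))}
    (hcl : IsClosed K) (hK : Convex ℝ K) {a : Fin d → Fin m} (h : NearBoundary m ρ K a) :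
    ∃ (i : Fin d) (s : Bool), NearFace m ρ K i (if s then 1 else -1) a := by
  obtain ⟨x, hx, ⟨k, hk, hxk⟩, y, hy, hxy⟩ := h
  obtain ⟨p, hp, hpw⟩ := exists_projection ⟨k, hk⟩ hcl hK y
  have hu0 : y - p ≠ 0 := fun h0 => hy (by rwa [sub_eq_zero.1 h0])
  obtain ⟨j, hj⟩ : ∃ j, (y - p) j ≠ 0 := by
    by_contra hcon
    push Not at hcon
    exact hu0 (by ext j; simpa using hcon j)
  obtain ⟨i, -, hi⟩ := Finset.exists_max_image Finset.univ (fun j => |(y - p) j|) ⟨j, by simp⟩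
  have hi0 : 0 < |(y - p) i| := lt_of_lt_of_le (abs_pos.2 hj) (hi j (by simp))
  have hsep : ∀ w ∈ K, ⟪w, y - p⟫ ≤ ⟪y, y - p⟫ := fun w hw => by
    have h1 := hpw w hw
    have h2 : 0 ≤ ⟪y - p, y - p⟫ := real_inner_self_nonneg
    have h3 : ⟪w, y - p⟫ = ⟪y - p, w - p⟫ + ⟪p, y - p⟫ := by
      rw [real_inner_comm (y - p) w, inner_sub_right (y - p) w p, real_inner_comm (y - p) p]; ring
    have h4 : ⟪y, y - p⟫ = ⟪y - p, y - p⟫ + ⟪p, y - p⟫ := by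
      rw [← inner_add_left, sub_add_cancel]
    linarith
  rcases lt_or_ge ((y - p) i) 0 with hneg | hpos
  · have h1 : ∀ j, |(y - p) j| ≤ |(y - p) i| := fun j => hi j (by simp)
    rw [abs_of_neg hneg] at h1
    refine ⟨i, false, x, hx, ⟨k, hk, hxk⟩, y, hxy, y - p, hsep, ?_, fun j => ?_⟩
    · simpa using hneg
    · simpa using h1 j
  · have h1 : ∀ j, |(y - p) j| ≤ |(y - p) i| := fun j => hi j (by simp)
    rw [abs_of_nonneg hpos] at h1 hi0
    refine ⟨i, true, x, hx, ⟨k, hk, hxk⟩, y, hxy, y - p, hsep, ?_, fun j => ?_⟩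
    · simpa using hi0
    · simpa using h1 j

theorem abs_sum_mul_le {v u : Fin d → ℝ} {c U : ℝ} (hv : ∀ j, |v j| ≤ c) (hu : ∀ j, |u j| ≤ U) :
    |∑ j, v j * u j| ≤ d * (c * U) := by
  refine (Finset.abs_sum_le_sum_abs _ _).trans ?_
  have : ∀ j ∈ Finset.univ, |v j * u j| ≤ c * U := fun j _ => by
    rw [abs_mul]
    exact mul_le_mul (hv j) (hu j) (abs_nonneg _) ((abs_nonneg _).trans (hv j))
  simpa using Finset.sum_le_card_nsmul Finset.univ _ _ this

/-- Each step along `s • e i` raises `⟪·, u⟫` by the largest coordinate of the normal `u`, in units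
of the mesh. Far up the column a point near `K` would thus violate the supporting inequality of the
first cell. The slack is `ρ` for each of the two approximations and `1` for positions inside the
cells, each multiplied by `d`. -/
theorem NearFace.column_le {m ρ : ℕ} {K : Set (EuclideanSpace ℝ (Fin d))} {i : Fin d} {s : ℝ}
    (hs : s * s = 1) {a b : Fin d → Fin m} (ha : NearFace m ρ K i s a)
    (hb : NearFace m ρ K i s b) (hab : ∀ j, j ≠ i → a j = b j) :
    s * ((b i : ℝ) - a i) ≤ d * (2 * ρ + 1) := by
  obtain ⟨x, hx, -, y, hxy, u, hsep, hpos, hu⟩ := ha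
  obtain ⟨x', hx', ⟨k, hk, hxk⟩, -⟩ := hb
  set U := s * u i with hU
  have h1 := hsep k hk
  rw [EuclideanSpace.inner_eq_sum_mul, EuclideanSpace.inner_eq_sum_mul] at h1
  have h2 := (abs_le.1 (abs_sum_mul_le (v := fun j => (m : ℝ) * x' j - m * k j) hxk hu)).2
  have h3 := (abs_le.1 (abs_sum_mul_le (v := fun j => (m : ℝ) * x j - m * y j) hxy hu)).1
  have h4 := (abs_le.1 (abs_sum_mul_le (c := 1) (U := U) (u := u)
    (v := fun j => ((m : ℝ) * x' j - b j) - (m * x j - a j)) (fun j => by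
      have e1 := hx j
      have e2 := hx' j
      rw [abs_le]
      constructor <;> linarith [e1.1, e1.2, e2.1, e2.2]) hu)).1
  have h5 : ∑ j, ((b j : ℝ) - a j) * u j = (b i - a i) * u i := by
    refine Finset.sum_eq_single i (fun j _ hj => ?_) (by simp)
    rw [hab j hj]; ring
  have h6 : ∑ j, ((b j : ℝ) - a j) * u j = ∑ j, ((m : ℝ) * x' j - m * k j) * u j
      - ∑ j, ((m : ℝ) * x j - m * y j) * u j
      - ∑ j, (((m : ℝ) * x' j - b j) - (m * x j - a j)) * u j
      + m * (∑ j, k j * u j - ∑ j, y j * u j) := by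
    rw [← Finset.sum_sub_distrib, ← Finset.sum_sub_distrib, ← Finset.sum_sub_distrib,
      Finset.mul_sum, ← Finset.sum_add_distrib]
    exact Finset.sum_congr rfl fun j _ => by ring
  have h7 : (m : ℝ) * (∑ j, k j * u j - ∑ j, y j * u j) ≤ 0 :=
    mul_nonpos_of_nonneg_of_nonpos (by positivity) (by linarith)
  have h8 : ((b i : ℝ) - a i) * u i = s * (b i - a i) * U := by
    rw [hU]; linear_combination (-((b i : ℝ) - a i) * u i) * hs
  refine le_of_mul_le_mul_right ?_ hpos
  rw [← h8, ← h5, h6]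
  linarith

open Classical in
theorem card_nearFace_le (m ρ : ℕ) (K : Set (EuclideanSpace ℝ (Fin d))) (i : Fin d) {s : ℝ}
    (hs : s * s = 1) :
    (Finset.univ.filter fun a : Fin d → Fin m => NearFace m ρ K i s a).card ≤
      m ^ (d - 1) * (d * (2 * ρ + 1) + 1) := by
  set J := d * (2 * ρ + 1) with hJ
  -- Cells of one column lie within `J` of each other, so the residue modulo `J + 1` determines the
  -- height and each of the `m ^ (d - 1)` columns holds at most `J + 1` of them.
  let f : (Fin d → Fin m) → ({j // j ≠ i} → Fin m) × Fin (J + 1) := fun a =>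
    (fun j => a j, ⟨(a i : ℕ) % (J + 1), Nat.mod_lt _ (Nat.succ_pos _)⟩)
  have hcard : Fintype.card (({j // j ≠ i} → Fin m) × Fin (J + 1)) = m ^ (d - 1) * (J + 1) := by
    simp
  rw [← hcard, ← Finset.card_univ]
  refine Finset.card_le_card_of_injOn f (by simp) ?_
  intro a ha b hb hab
  simp only [Finset.coe_filter, Finset.mem_univ, true_and, Set.mem_ofPred_eq] at ha hb
  have h1 : ∀ j, j ≠ i → a j = b j := fun j hj =>
    congrFun (congrArg Prod.fst hab) ⟨j, hj⟩
  have h2 : (a i : ℕ) ≡ b i [MOD (J + 1)] := congrArg Fin.val (congrArg Prod.snd hab)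
  have h3 := ha.column_le hs hb h1
  have h4 := hb.column_le hs ha fun j hj => (h1 j hj).symm
  have h5 : |((b i : ℝ) - a i)| ≤ J := by
    have hs' : |s| = 1 := by
      have := congrArg abs hs
      rw [abs_mul, abs_one] at this
      nlinarith [abs_nonneg s]
    have h6 : |s * ((b i : ℝ) - a i)| ≤ J := by
      rw [abs_le]
      push_cast [hJ]
      constructor <;> linarith
    rwa [abs_mul, hs', one_mul] at h6
  have h6 : |((b i : ℕ) : ℤ) - ((a i : ℕ) : ℤ)| ≤ J := by exact_mod_cast h5
  have h7 : ((J + 1 : ℕ) : ℤ) ∣ ((b i : ℕ) : ℤ) - ((a i : ℕ) : ℤ) :=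
    (Nat.modEq_iff_dvd).1 h2
  have h8 : ((b i : ℕ) : ℤ) - ((a i : ℕ) : ℤ) = 0 :=
    Int.eq_zero_of_abs_lt_dvd h7 (by push_cast; linarith)
  funext j
  by_cases hj : j = i
  · subst hj
    exact Fin.ext (by omega)
  · exact h1 j hj

open Classical in
theorem card_nearBoundary_le (m ρ : ℕ) {K : Set (EuclideanSpace ℝ (Fin d))} (hcl : IsClosed K)
    (hK : Convex ℝ K) :
    (Finset.univ.filter fun a : Fin d → Fin m => NearBoundary m ρ K a).card ≤
      2 * d * (d * (2 * ρ + 1) + 1) * m ^ (d - 1) := by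
  have hsub : (Finset.univ.filter fun a : Fin d → Fin m => NearBoundary m ρ K a) ⊆
      (Finset.univ : Finset (Fin d × Bool)).biUnion fun p => Finset.univ.filter
        fun a : Fin d → Fin m => NearFace m ρ K p.1 (if p.2 then 1 else -1) a := by
    intro a ha
    obtain ⟨i, s, h⟩ := ((Finset.mem_filter.1 ha).2).exists_nearFace hcl hK
    simp only [Finset.mem_biUnion, Finset.mem_univ, true_and, Finset.mem_filter]
    exact ⟨(i, s), h⟩
  refine (Finset.card_le_card hsub).trans ((Finset.card_biUnion_le_card_mul _ _
    (m ^ (d - 1) * (d * (2 * ρ + 1) + 1)) fun p _ => card_nearFace_le m ρ K p.1 ?_).trans ?_)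
  · rcases p.2 <;> norm_num
  · simp only [Finset.card_univ, Fintype.card_prod, Fintype.card_fin, Fintype.card_bool]
    exact le_of_eq (by ring)

theorem mem_gridCell_halfOpenCube {m : ℕ} (hm : 0 < m) {a : Fin d → Fin m}
    {x : EuclideanSpace ℝ (Fin d)} (hx : x ∈ gridCell m a) : x ∈ halfOpenCube d := by
  intro i
  have hm' : (0 : ℝ) < m := by exact_mod_cast hm
  have h1 := hx i
  have h2 : (a i : ℝ) + 1 ≤ m := by exact_mod_cast (a i).2
  have h3 : (0 : ℝ) ≤ (a i : ℝ) := by positivity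
  constructor
  · by_contra hcon
    push Not at hcon
    nlinarith
  · by_contra hcon
    push Not at hcon
    nlinarith

theorem exists_mem_gridCell {m : ℕ} (hm : 0 < m) {x : EuclideanSpace ℝ (Fin d)}
    (hx : x ∈ halfOpenCube d) : ∃ a : Fin d → Fin m, x ∈ gridCell m a := by
  have hm' : (0 : ℝ) < m := by exact_mod_cast hm
  have h0 : ∀ i, 0 ≤ (m : ℝ) * x i := fun i => mul_nonneg hm'.le (hx i).1
  refine ⟨fun i => ⟨⌊(m : ℝ) * x i⌋₊, ?_⟩, fun i => ⟨Nat.floor_le (h0 i), Nat.lt_floor_add_one _⟩⟩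
  rw [Nat.floor_lt (h0 i)]
  nlinarith [(hx i).2]

theorem gridCell_injective {m : ℕ} {a b : Fin d → Fin m} {x : EuclideanSpace ℝ (Fin d)}
    (ha : x ∈ gridCell m a) (hb : x ∈ gridCell m b) : a = b := by
  funext i
  have h1 := ha i
  have h2 := hb i
  have h3 : (a i : ℝ) < b i + 1 := by linarith [h1.1, h2.2]
  have h4 : (b i : ℝ) < a i + 1 := by linarith [h1.2, h2.1]
  have h5 : (a i : ℕ) < b i + 1 := by exact_mod_cast h3
  have h6 : (b i : ℕ) < a i + 1 := by exact_mod_cast h4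
  exact Fin.ext (by omega)

theorem measurableSet_gridCell (m : ℕ) (a : Fin d → Fin m) : MeasurableSet (gridCell m a) := by
  have : gridCell m a = ⋂ i, (fun x : EuclideanSpace ℝ (Fin d) => (m : ℝ) * x i) ⁻¹'
      Set.Ico (a i : ℝ) (a i + 1) := by
    ext x; simp [gridCell]
  rw [this]
  exact MeasurableSet.iInter fun i => (by fun_prop : Measurable _) measurableSet_Ico

theorem volume_gridCell {m : ℕ} (hm : 0 < m) (a : Fin d → Fin m) :
    volume (gridCell m a) = ENNReal.ofReal ((1 / (m : ℝ)) ^ d) := by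
  have hm' : (0 : ℝ) < m := by exact_mod_cast hm
  have hpre : (WithLp.toLp 2) ⁻¹' (gridCell m a) =
      Set.univ.pi fun i : Fin d => Set.Ico ((a i : ℝ) / m) ((a i + 1) / m) := by
    ext x
    simp only [gridCell, Set.mem_preimage, Set.mem_ofPred_eq, Set.mem_pi, Set.mem_univ,
      true_imp_iff, Set.mem_Ico, div_le_iff₀ hm', lt_div_iff₀ hm', mul_comm (m : ℝ)]
  rw [← (PiLp.volume_preserving_toLp (Fin d)).measure_preimage
    (measurableSet_gridCell m a).nullMeasurableSet, hpre, Real.volume_pi_Ico,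
    ← ENNReal.ofReal_prod_of_nonneg]
  · congr 1
    have : ∀ i : Fin d, ((a i : ℝ) + 1) / m - a i / m = 1 / m := fun i => by ring
    simp [this]
  · intro i _
    rw [← sub_div]
    have : (a i : ℝ) + 1 - a i = 1 := by ring
    rw [this]
    positivity

theorem volume_real_nearBoundary_le {m : ℕ} (hm : 0 < m) (ρ : ℕ)
    {K : Set (EuclideanSpace ℝ (Fin d))} (hd : 0 < d) (hcl : IsClosed K) (hK : Convex ℝ K) :
    volume.real {x ∈ halfOpenCube d | (∃ k ∈ K, GridNear m ρ x k) ∧ ∃ y ∉ K, GridNear m ρ x y} ≤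
      2 * d * (d * (2 * ρ + 1) + 1) / m := by
  classical
  have hm' : (0 : ℝ) < m := by exact_mod_cast hm
  set A := Finset.univ.filter fun a : Fin d → Fin m => NearBoundary m ρ K a with hA
  have hsub : {x ∈ halfOpenCube d | (∃ k ∈ K, GridNear m ρ x k) ∧ ∃ y ∉ K, GridNear m ρ x y} ⊆
      ⋃ a ∈ A, gridCell m a := by
    rintro x ⟨hx, hn⟩
    obtain ⟨a, ha⟩ := exists_mem_gridCell hm hx
    simp only [Set.mem_iUnion, exists_prop]
    exact ⟨a, Finset.mem_filter.2 ⟨Finset.mem_univ _, x, ha, hn⟩, ha⟩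
  have hreal : ∀ a : Fin d → Fin m, volume.real (gridCell m a) = (1 / (m : ℝ)) ^ d := fun a => by
    rw [Measure.real, volume_gridCell hm, ENNReal.toReal_ofReal (by positivity)]
  have hcard := card_nearBoundary_le m ρ hcl hK
  rw [← hA] at hcard
  have hcard' : (A.card : ℝ) ≤ 2 * d * (d * (2 * ρ + 1) + 1) * (m : ℝ) ^ (d - 1) := by
    exact_mod_cast hcard
  calc _ ≤ volume.real (⋃ a ∈ A, gridCell m a) := by
        refine measureReal_mono hsub ?_
        exact (measure_biUnion_lt_top A.finite_toSet fun a _ => by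
          simp [volume_gridCell hm]).ne
    _ ≤ ∑ a ∈ A, volume.real (gridCell m a) := measureReal_biUnion_finset_le _ _
    _ = A.card * (1 / (m : ℝ)) ^ d := by simp [hreal]
    _ ≤ 2 * d * (d * (2 * ρ + 1) + 1) * (m : ℝ) ^ (d - 1) * (1 / (m : ℝ)) ^ d := by gcongr
    _ = _ := by
        obtain ⟨e, rfl⟩ : ∃ e, d = e + 1 := ⟨d - 1, by omega⟩
        rw [Nat.add_sub_cancel, one_div, inv_pow, pow_succ]
        field_simp

end ConvexCells

/-! ### Convex bodies are determined by projections of few points -/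

section ConvexEntropy

variable {d : ℕ}

/-- The closed unit cube. -/
def closedUnitCube (d : ℕ) : Set (EuclideanSpace ℝ (Fin d)) :=
  {x | ∀ i, x i ∈ Set.Icc (0 : ℝ) 1}

theorem isCompact_closedUnitCube : IsCompact (closedUnitCube d) := by
  have : closedUnitCube d = (EuclideanSpace.equiv (Fin d) ℝ).toHomeomorph ⁻¹'
      Set.univ.pi fun _ => Set.Icc (0 : ℝ) 1 := by
    ext x
    simp only [closedUnitCube, Set.mem_preimage, Set.mem_pi, Set.mem_univ, true_imp_iff]
    rfl
  rw [this, Homeomorph.isCompact_preimage]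
  exact isCompact_univ_pi fun _ => isCompact_Icc

theorem closure_subset_closedUnitCube {K : Set (EuclideanSpace ℝ (Fin d))}
    (hK : K ⊆ halfOpenCube d) : closure K ⊆ closedUnitCube d :=
  closure_minimal (fun _ hx i => Set.Ico_subset_Icc_self (hK hx i))
    isCompact_closedUnitCube.isClosed

theorem exists_ray_supNorm_eq_two {x : EuclideanSpace ℝ (Fin d)} (hx : x ∈ closedUnitCube d)
    {v : EuclideanSpace ℝ (Fin d)} (hv : v ≠ 0) :
    ∃ T : ℝ, 0 ≤ T ∧ ‖WithLp.ofLp (x + T • v)‖ = 2 := by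
  have hv' : 0 < ‖WithLp.ofLp v‖ := norm_pos_iff.2 fun h => hv (by ext i; simp [h])
  have hx' : ‖WithLp.ofLp x‖ ≤ 1 := (pi_norm_le_iff_of_nonneg zero_le_one).2 fun i => by
    rw [Real.norm_eq_abs, abs_of_nonneg (hx i).1]
    exact (hx i).2
  -- A displacement of sup norm `3` from a point of norm at most `1` reaches norm at least `2`.
  set T₀ := 3 / ‖WithLp.ofLp v‖ with hT₀
  have hcont : Continuous fun T : ℝ => ‖WithLp.ofLp (x + T • v)‖ := by fun_prop
  have h0 : ‖WithLp.ofLp (x + (0 : ℝ) • v)‖ ≤ 2 := by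
    rw [zero_smul, add_zero]; linarith
  have h1 : 2 ≤ ‖WithLp.ofLp (x + T₀ • v)‖ := by
    have h2 : ‖T₀ • WithLp.ofLp v‖ = 3 := by
      rw [norm_smul, Real.norm_eq_abs, abs_of_pos (by positivity), hT₀]
      field_simp
    have h3 : T₀ • WithLp.ofLp v = WithLp.ofLp (x + T₀ • v) - WithLp.ofLp x := by
      simp
    have h4 := norm_sub_le (WithLp.ofLp (x + T₀ • v)) (WithLp.ofLp x)
    rw [← h3, h2] at h4
    linarith
  obtain ⟨T, hT, h⟩ := intermediate_value_Icc (by positivity : (0 : ℝ) ≤ T₀)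
    hcont.continuousOn ⟨h0, h1⟩
  exact ⟨T, hT.1, h⟩

/-- The integer points on the boundary of the cube `[-M, M]^d`. -/
noncomputable def shell (d M : ℕ) : Finset (Fin d → ℤ) :=
  (Fintype.piFinset fun _ => Finset.Icc (-(M : ℤ)) M) \
    Fintype.piFinset fun _ => Finset.Icc (-(M : ℤ) + 1) (M - 1)

theorem pow_add_two_le (x d : ℕ) : (x + 2) ^ d ≤ x ^ d + 2 * d * (x + 2) ^ (d - 1) := by
  induction d with
  | zero => simp
  | succ e ih =>
    rcases Nat.eq_zero_or_pos e with rfl | he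
    · simp
    · obtain ⟨f, rfl⟩ : ∃ f, e = f + 1 := ⟨e - 1, by omega⟩
      simp only [Nat.add_sub_cancel] at ih ⊢
      calc (x + 2) ^ (f + 1 + 1) = x * (x + 2) ^ (f + 1) + 2 * (x + 2) ^ (f + 1) := by ring
        _ ≤ x * (x ^ (f + 1) + 2 * (f + 1) * (x + 2) ^ f) + 2 * (x + 2) ^ (f + 1) := by
          gcongr
        _ ≤ x * x ^ (f + 1) + 2 * (f + 1) * ((x + 2) * (x + 2) ^ f)
            + 2 * (x + 2) ^ (f + 1) := by
          have : x * (2 * (f + 1) * (x + 2) ^ f) ≤ 2 * (f + 1) * ((x + 2) * (x + 2) ^ f) := by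
            calc _ = 2 * (f + 1) * (x * (x + 2) ^ f) := by ring
              _ ≤ _ := by gcongr; omega
          nlinarith
        _ = _ := by ring

/-- A difference of `d`-th powers: the exponent `d - 1` is what makes the later union bound
affordable. -/
theorem card_shell_le {M : ℕ} (hM : 0 < M) :
    (shell d M).card ≤ 2 * d * (2 * M + 1) ^ (d - 1) := by
  have hsub : (Fintype.piFinset fun _ : Fin d => Finset.Icc (-(M : ℤ) + 1) (M - 1)) ⊆
      Fintype.piFinset fun _ : Fin d => Finset.Icc (-(M : ℤ)) M :=
    Fintype.piFinset_subset _ _ fun _ => Finset.Icc_subset_Icc (by omega) (by omega)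
  rw [shell, Finset.card_sdiff_of_subset hsub, Fintype.card_piFinset, Fintype.card_piFinset]
  simp only [Int.card_Icc, Finset.prod_const, Finset.card_univ, Fintype.card_fin]
  have h1 : ((M : ℤ) + 1 - -(M : ℤ)).toNat = (2 * M - 1) + 2 := by omega
  have h2 : ((M : ℤ) - 1 + 1 - (-(M : ℤ) + 1)).toNat = 2 * M - 1 := by omega
  have h3 := pow_add_two_le (2 * M - 1) d
  rw [h1, h2, show 2 * M + 1 = 2 * M - 1 + 2 by omega]
  omega

/-- The point of `[-2, 2]^d` with grid coordinates `g`. -/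
noncomputable def shellPoint (M : ℕ) (g : Fin d → ℤ) : EuclideanSpace ℝ (Fin d) :=
  WithLp.toLp 2 fun j => 2 * (g j : ℝ) / M

theorem exists_shellPoint_near {M : ℕ} (hM : 0 < M) {p : EuclideanSpace ℝ (Fin d)}
    (hp : ‖WithLp.ofLp p‖ = 2) :
    ∃ g ∈ shell d M, ∀ j, |p j - shellPoint M g j| ≤ 2 / M := by
  have hM' : (0 : ℝ) < M := by exact_mod_cast hM
  have hle : ∀ j, |p j| ≤ 2 := fun j => by
    rw [← Real.norm_eq_abs, ← hp]; exact norm_le_pi_norm (WithLp.ofLp p) j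
  obtain ⟨i, hi⟩ : ∃ i, 2 ≤ |p i| := by
    by_contra hcon
    push Not at hcon
    have := (pi_norm_lt_iff (x := WithLp.ofLp p) two_pos).2 hcon
    linarith
  have hlow : ∀ j, -(M : ℝ) ≤ p j * M / 2 := fun j => by
    have := (abs_le.1 (hle j)).1; nlinarith
  have hupp : ∀ j, p j * M / 2 ≤ M := fun j => by
    have := (abs_le.1 (hle j)).2; nlinarith
  refine ⟨fun j => ⌊p j * M / 2⌋, ?_, fun j => ?_⟩
  · rw [shell, Finset.mem_sdiff, Fintype.mem_piFinset, Fintype.mem_piFinset]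
    refine ⟨fun j => Finset.mem_Icc.2 ⟨?_, ?_⟩, fun h => ?_⟩
    · rw [Int.le_floor]; push_cast; exact hlow j
    · have : (⌊p j * M / 2⌋ : ℝ) ≤ M := (Int.floor_le _).trans (hupp j)
      exact_mod_cast this
    -- The coordinate of modulus `2` scales to exactly `±M`, so taking floors leaves it on the
    -- boundary.
    · have h1 := Finset.mem_Icc.1 (h i)
      rcases le_abs'.1 hi with h2 | h2
      · have h3 : p i * M / 2 = ((-(M : ℤ) : ℤ) : ℝ) := by
          push_cast
          exact le_antisymm (by nlinarith) (hlow i)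
        rw [h3, Int.floor_intCast] at h1
        omega
      · have h3 : p i * M / 2 = ((M : ℤ) : ℝ) := by
          push_cast
          exact le_antisymm (hupp i) (by nlinarith)
        rw [h3, Int.floor_intCast] at h1
        omega
  · simp only [shellPoint]
    have h1 := Int.floor_le (p j * M / 2)
    have h2 := Int.lt_floor_add_one (p j * M / 2)
    have h3 : p j - 2 * (⌊p j * M / 2⌋ : ℝ) / M = 2 * (p j * M / 2 - ⌊p j * M / 2⌋) / M := by
      field_simp
    rw [h3, abs_of_nonneg (div_nonneg (by linarith) hM'.le)]
    gcongr
    linarith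

theorem abs_shellPoint_le {M : ℕ} (hM : 0 < M) {g : Fin d → ℤ} (hg : g ∈ shell d M) (j : Fin d) :
    |shellPoint M g j| ≤ 2 := by
  have hM' : (0 : ℝ) < M := by exact_mod_cast hM
  rw [shell, Finset.mem_sdiff, Fintype.mem_piFinset] at hg
  have h1 := Finset.mem_Icc.1 (hg.1 j)
  have h2 : |(g j : ℝ)| ≤ M := by
    rw [abs_le]; exact ⟨by exact_mod_cast h1.1, by exact_mod_cast h1.2⟩
  simp only [shellPoint]
  rw [abs_div, abs_mul, abs_two, abs_of_pos hM', div_le_iff₀ hM']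
  linarith

/-- `y` is the metric projection of `q` onto `K`. -/
def IsProjection (K : Set (EuclideanSpace ℝ (Fin d))) (q y : EuclideanSpace ℝ (Fin d)) : Prop :=
  y ∈ K ∧ ∀ w ∈ K, ⟪q - y, w - y⟫ ≤ 0

theorem abs_inner_le {v u : EuclideanSpace ℝ (Fin d)} {c U : ℝ} (hv : ∀ j, |v j| ≤ c)
    (hu : ∀ j, |u j| ≤ U) : |⟪v, u⟫| ≤ d * (c * U) := by
  rw [EuclideanSpace.inner_eq_sum_mul]
  exact abs_sum_mul_le hv hu

/-- If the projections of all points of the shell onto two convex sets are close to each other,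
then the convex sets are close to each other. -/
theorem dist_le_of_projections_near (hd : 0 < d) {M : ℕ} (hM : 16 * d ≤ M ^ 2)
    {K K' : Set (EuclideanSpace ℝ (Fin d))} (hne : K.Nonempty)
    (hcl : IsClosed K) (hK : Convex ℝ K) (hKc : K ⊆ closedUnitCube d)
    (hKc' : K' ⊆ closedUnitCube d)
    (hnear : ∀ g ∈ shell d M, ∃ y y', IsProjection K (shellPoint M g) y ∧
      IsProjection K' (shellPoint M g) y' ∧ ∀ j, |y j - y' j| ≤ 1 / (M : ℝ) ^ 2)
    {z : EuclideanSpace ℝ (Fin d)} (hz : z ∈ K') : ∃ x ∈ K, ‖z - x‖ ≤ 16 * d / (M : ℝ) ^ 2 := by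
  have hM0 : 0 < M := by
    rcases Nat.eq_zero_or_pos M with rfl | h
    · simp at hM; omega
    · exact h
  have hMr : (0 : ℝ) < M := by exact_mod_cast hM0
  obtain ⟨x, hx, hxz⟩ := exists_projection hne hcl hK z
  refine ⟨x, hx, ?_⟩
  by_cases hzx : z - x = 0
  · rw [hzx, norm_zero]; positivity
  -- Follow the outer normal from `x` through `z` to the surface of `[-2, 2]^d`. The point `p`
  -- reached there still projects to `x`, and `q` is a shell point close to it.
  obtain ⟨T, hT0, hT⟩ := exists_ray_supNorm_eq_two (hKc hx) hzx
  obtain ⟨g, hg, hpg⟩ := exists_shellPoint_near hM0 hT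
  obtain ⟨y, y', ⟨hy, hyq⟩, ⟨hy', hyq'⟩, hyy⟩ := hnear g hg
  set q := shellPoint M g with hq
  set p := x + T • (z - x) with hp
  set η := ‖p - q‖ with hη
  have hηsq : η ^ 2 ≤ 4 * d / (M : ℝ) ^ 2 := by
    have h1 := (le_abs_self _).trans (abs_inner_le (v := p - q) (u := p - q) hpg hpg)
    rw [real_inner_self_eq_norm_sq] at h1
    refine h1.trans (le_of_eq ?_)
    field_simp
    norm_num
  -- This is the use of `16 * d ≤ M ^ 2`: it gives `η ≤ 1 / 2`, so replacing `r` by `s` costs at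
  -- most half of `‖z - x‖`.
  have hM16 : 4 * (d : ℝ) / (M : ℝ) ^ 2 ≤ 1 / 4 := by
    rw [div_le_iff₀ (by positivity)]
    have : (16 * d : ℝ) ≤ (M : ℝ) ^ 2 := by exact_mod_cast hM
    linarith
  have hη0 : 0 ≤ η := norm_nonneg _
  have hηhalf : η ≤ 1 / 2 := by nlinarith
  have hpx : p - x = T • (z - x) := by rw [hp]; abel
  have hone : 1 ≤ ‖p - x‖ := by
    have hx' : ‖WithLp.ofLp x‖ ≤ 1 := (pi_norm_le_iff_of_nonneg zero_le_one).2 fun i => by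
      rw [Real.norm_eq_abs, abs_of_nonneg (hKc hx i).1]
      exact (hKc hx i).2
    have h1 : ‖WithLp.ofLp p - WithLp.ofLp x‖ ≤ ‖p - x‖ :=
      (pi_norm_le_iff_of_nonneg (norm_nonneg _)).2 fun i => PiLp.norm_apply_le (p - x) i
    have h2 := norm_sub_norm_le (WithLp.ofLp p) (WithLp.ofLp x)
    linarith
  have hproj : ∀ w ∈ K, ⟪p - x, w - x⟫ ≤ 0 := fun w hw => by
    rw [hpx, real_inner_smul_left]
    exact mul_nonpos_of_nonneg_of_nonpos hT0 (hxz w hw)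
  have hin : ⟪p - x, z - x⟫ = ‖p - x‖ * ‖z - x‖ := by
    rw [hpx, real_inner_smul_left, real_inner_self_eq_norm_sq, norm_smul, Real.norm_eq_abs,
      abs_of_nonneg hT0]
    ring
  set r := p - x with hr
  set s := q - y with hs
  set e := x - y with he
  have hre : 0 ≤ ⟪r, e⟫ := by
    have h1 := hproj y hy
    rw [show y - x = -e by rw [he]; abel, inner_neg_right] at h1
    linarith
  have hse : ⟪s, e⟫ ≤ 0 := hyq x hx
  have hpq : p - q = (r - s) + e := by rw [hr, hs, he]; abel
  -- Since `⟪r, e⟫ ≥ 0 ≥ ⟪s, e⟫`, every term on the right is nonnegative. The cross term is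
  -- therefore at most `η ^ 2`, of order `1 / M ^ 2`: the quadratic gain over the spacing.
  have hηeq : η ^ 2 = ‖r - s‖ ^ 2 + 2 * ⟪r - s, e⟫ + ‖e‖ ^ 2 := by
    rw [hη, hpq, norm_add_sq_real]
  have hrse : ⟪r - s, e⟫ = ⟪r, e⟫ - ⟪s, e⟫ := inner_sub_left _ _ _
  have hrs : ‖r - s‖ ≤ η := by
    refine le_of_sq_le_sq ?_ hη0
    nlinarith [sq_nonneg ‖e‖]
  have hrse' : ⟪r - s, e⟫ ≤ η ^ 2 := by nlinarith [sq_nonneg ‖e‖, sq_nonneg ‖r - s‖]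
  -- Projection onto `K'` gives the exact inequality at `y'`. Moving to `y` costs `d / M ^ 2` times
  -- `1 + 3`, which bound the coordinates of `z - y'` and of `q - y`.
  have hs1 : ⟪s, z - y⟫ ≤ 4 * d / (M : ℝ) ^ 2 := by
    have h1 := hyq' z hz
    have h2 : ⟪s, z - y⟫ = ⟪q - y', z - y'⟫ - ⟪y - y', z - y'⟫ - ⟪y - y', s⟫ := by
      rw [real_inner_comm s (y - y')]
      have e1 : z - y = (z - y') - (y - y') := by abel
      have e2 : q - y' = s + (y - y') := by rw [hs]; abel
      rw [e1, e2, inner_sub_right, inner_add_left]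
      ring
    have h3 : |⟪y - y', z - y'⟫| ≤ d * (1 / (M : ℝ) ^ 2 * 1) := abs_inner_le hyy fun j => by
      have e1 := hKc' hz j
      have e2 := hKc' hy' j
      simp only [PiLp.sub_apply]
      rw [abs_le]
      constructor <;> linarith [e1.1, e1.2, e2.1, e2.2]
    have h4 : |⟪y - y', s⟫| ≤ d * (1 / (M : ℝ) ^ 2 * 3) := abs_inner_le hyy fun j => by
      have e1 := abs_le.1 (abs_shellPoint_le hM0 hg j)
      have e2 := hKc hy j
      rw [hs]
      simp only [PiLp.sub_apply]
      rw [abs_le]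
      constructor <;> linarith [e1.1, e1.2, e2.1, e2.2]
    have h5 : 4 * d / (M : ℝ) ^ 2 = d * (1 / (M : ℝ) ^ 2 * 1) + d * (1 / (M : ℝ) ^ 2 * 3) := by
      ring
    linarith [(abs_le.1 h3).1, (abs_le.1 h4).1]
  have hs2 : ⟪s, z - y⟫ = ⟪r, z - x⟫ - ⟪r - s, z - x⟫ + ⟪r, e⟫ - ⟪r - s, e⟫ := by
    rw [show z - y = (z - x) + e by rw [he]; abel, inner_add_right, inner_sub_left r s,
      inner_sub_left r s]
    ring
  have hs3 : ⟪r - s, z - x⟫ ≤ η * ‖z - x‖ :=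
    (real_inner_le_norm _ _).trans (by gcongr)
  have hzx0 : 0 ≤ ‖z - x‖ := norm_nonneg _
  have hfin : ‖z - x‖ / 2 ≤ 4 * d / (M : ℝ) ^ 2 + 4 * d / (M : ℝ) ^ 2 := by
    nlinarith
  have : 16 * (d : ℝ) / (M : ℝ) ^ 2 = 2 * (4 * d / (M : ℝ) ^ 2 + 4 * d / (M : ℝ) ^ 2) := by ring
  rw [this]
  linarith

end ConvexEntropy

/-! ### Bracketing convex sets by inner and outer parallel bodies -/

section ConvexBrackets

open scoped Pointwise

variable {d : ℕ}

/-- The set of all points at distance at most `ε` from `K`. -/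
def outerParallel (ε : ℝ) (K : Set (EuclideanSpace ℝ (Fin d))) : Set (EuclideanSpace ℝ (Fin d)) :=
  {x | ∃ k ∈ K, ‖x - k‖ ≤ ε}

/-- The set of all points whose closed `ε`-ball is contained in `K`. -/
def innerParallel (ε : ℝ) (K : Set (EuclideanSpace ℝ (Fin d))) : Set (EuclideanSpace ℝ (Fin d)) :=
  {x | ∀ v, ‖v‖ ≤ ε → x + v ∈ K}

theorem outerParallel_eq (ε : ℝ) (K : Set (EuclideanSpace ℝ (Fin d))) :
    outerParallel ε K = K + Metric.closedBall (0 : EuclideanSpace ℝ (Fin d)) ε := by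
  ext x
  rw [Set.mem_add]
  constructor
  · rintro ⟨k, hk, h⟩
    exact ⟨k, hk, x - k, by simpa using h, by abel⟩
  · rintro ⟨k, hk, v, hv, rfl⟩
    exact ⟨k, hk, by simpa using hv⟩

theorem Convex.outerParallel {K : Set (EuclideanSpace ℝ (Fin d))} (hK : Convex ℝ K) (ε : ℝ) :
    Convex ℝ (outerParallel ε K) := by
  rw [outerParallel_eq]
  exact hK.add (convex_closedBall 0 ε)

theorem IsCompact.isClosed_outerParallel {K : Set (EuclideanSpace ℝ (Fin d))} (hK : IsCompact K)
    (ε : ℝ) : IsClosed (outerParallel ε K) := by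
  rw [outerParallel_eq]
  exact (hK.add (isCompact_closedBall 0 ε)).isClosed

theorem innerParallel_eq (ε : ℝ) (K : Set (EuclideanSpace ℝ (Fin d))) :
    innerParallel ε K = ⋂ v ∈ {v : EuclideanSpace ℝ (Fin d) | ‖v‖ ≤ ε}, (fun x => x + v) ⁻¹' K := by
  ext x; simp [innerParallel]

theorem Convex.innerParallel {K : Set (EuclideanSpace ℝ (Fin d))} (hK : Convex ℝ K) (ε : ℝ) :
    Convex ℝ (innerParallel ε K) := by
  rw [innerParallel_eq]
  exact convex_iInter₂ fun v _ => hK.translate_preimage_left v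

theorem IsClosed.innerParallel {K : Set (EuclideanSpace ℝ (Fin d))} (hK : IsClosed K) (ε : ℝ) :
    IsClosed (innerParallel ε K) := by
  rw [innerParallel_eq]
  exact isClosed_biInter fun v _ => hK.preimage (by fun_prop)

/-- A closed convex set containing, up to distance `ε`, the `2 ε`-neighbourhood of `x` contains
the `ε`-neighbourhood of `x`. -/
theorem closedBall_subset_of_innerParallel {K K₀ : Set (EuclideanSpace ℝ (Fin d))}
    (hcl : IsClosed K) (hne : K.Nonempty) (hK : Convex ℝ K) {ε : ℝ} (hε : 0 ≤ ε)
    (h : ∀ z ∈ K₀, ∃ x ∈ K, ‖z - x‖ ≤ ε) {x : EuclideanSpace ℝ (Fin d)}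
    (hx : x ∈ innerParallel (2 * ε) K₀) {v : EuclideanSpace ℝ (Fin d)} (hv : ‖v‖ ≤ ε) :
    x + v ∈ K := by
  by_contra hcon
  obtain ⟨p, hp, hpw⟩ := exists_projection hne hcl hK (x + v)
  set u := x + v - p with hu
  have hu0 : u ≠ 0 := fun h0 => hcon (by rwa [sub_eq_zero.1 h0])
  have hupos : 0 < ‖u‖ := norm_pos_iff.2 hu0
  -- Pushing a further `ε` along the outer normal stays in `K₀`, but lands more than `ε` beyond the
  -- supporting hyperplane of `K`.
  have hw : ‖v + (ε / ‖u‖) • u‖ ≤ 2 * ε := by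
    refine (norm_add_le _ _).trans ?_
    rw [norm_smul, Real.norm_eq_abs, abs_of_nonneg (by positivity), div_mul_cancel₀ _ hupos.ne']
    linarith
  obtain ⟨k, hk, hzk⟩ := h _ (hx _ hw)
  have h1 := hpw k hk
  have h2 : ⟪u, x + (v + (ε / ‖u‖) • u) - k⟫ ≤ ‖u‖ * ε :=
    (real_inner_le_norm _ _).trans (by gcongr)
  have h3 : x + (v + (ε / ‖u‖) • u) - k = u + (ε / ‖u‖) • u - (k - p) := by rw [hu]; abel
  rw [h3, inner_sub_right, inner_add_right, inner_smul_right, real_inner_self_eq_norm_sq] at h2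
  have h4 : ε / ‖u‖ * ‖u‖ ^ 2 = ‖u‖ * ε := by field_simp
  nlinarith [sq_nonneg ‖u‖, pow_pos hupos 2]

/-- As `K` need not be closed, a whole ball around `x` is placed in `closure K`. That makes the
closure non-null, and the frontier of a convex set is null, so `K` has interior; its interior then
equals that of its closure. -/
theorem innerParallel_subset {K K₀ : Set (EuclideanSpace ℝ (Fin d))}
    (hne : K.Nonempty) (hK : Convex ℝ K) {ε : ℝ} (hε : 0 < ε)
    (h : ∀ z ∈ K₀, ∃ x ∈ closure K, ‖z - x‖ ≤ ε) : innerParallel (2 * ε) K₀ ⊆ K := by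
  intro x hx
  have hball : Metric.ball x ε ⊆ closure K := fun y hy => by
    have := closedBall_subset_of_innerParallel isClosed_closure hne.closure hK.closure hε.le h hx
      (v := y - x) (by rw [← dist_eq_norm]; exact (Metric.mem_ball.1 hy).le)
    simpa using this
  have hxi : x ∈ interior (closure K) :=
    mem_interior.2 ⟨_, hball, Metric.isOpen_ball, Metric.mem_ball_self hε⟩
  have hint : (interior K).Nonempty := by
    by_contra hempty
    rw [Set.not_nonempty_iff_eq_empty] at hempty
    have hv : volume (interior (closure K)) = 0 := by
      have h1 : volume (closure K) = 0 := by
        have h0 := hK.addHaar_frontier volume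
        rw [frontier, hempty] at h0
        simpa using h0
      exact measure_mono_null interior_subset h1
    exact (isOpen_interior.measure_pos volume ⟨x, hxi⟩).ne' hv
  rw [hK.interior_closure_eq_interior_of_nonempty_interior hint] at hxi
  exact interior_subset hxi

/-- A point in the outer body but not the inner one is within `2ε = 32 d / M ^ 2` of both `K` and
its complement, that is, `32 d` steps of a grid of mesh `1 / M ^ 2`. -/
theorem volume_real_outerParallel_le (hd : 0 < d) {M : ℕ} (hM : 0 < M)
    {K : Set (EuclideanSpace ℝ (Fin d))} (hcl : IsClosed K) (hK : Convex ℝ K) :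
    volume.real (halfOpenCube d ∩ outerParallel (16 * d / (M : ℝ) ^ 2) K) ≤
      volume.real (halfOpenCube d ∩ innerParallel (2 * (16 * d / (M : ℝ) ^ 2)) K) +
        2 * d * (d * (2 * (32 * d) + 1) + 1) / (M : ℝ) ^ 2 := by
  set ε := 16 * d / (M : ℝ) ^ 2 with hε
  have hM' : (0 : ℝ) < (M : ℝ) ^ 2 := by positivity
  set N := {x ∈ halfOpenCube d | (∃ k ∈ K, GridNear (M ^ 2) (32 * d) x k) ∧
    ∃ y ∉ K, GridNear (M ^ 2) (32 * d) x y} with hN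
  have hnear : ∀ x y : EuclideanSpace ℝ (Fin d), ‖x - y‖ ≤ 2 * ε →
      GridNear (M ^ 2) (32 * d) x y := fun x y hxy j => by
    rw [← mul_sub, abs_mul, abs_of_nonneg (by positivity)]
    have h1 : |x j - y j| ≤ 2 * ε := (PiLp.norm_apply_le (x - y) j).trans hxy
    push_cast
    calc (M : ℝ) ^ 2 * |x j - y j| ≤ (M : ℝ) ^ 2 * (2 * ε) :=
          mul_le_mul_of_nonneg_left h1 (by positivity)
      _ = 32 * (d : ℝ) := by rw [hε]; field_simp; norm_num
  have hε0 : 0 ≤ ε := by positivity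
  have hsub : halfOpenCube d ∩ outerParallel ε K ⊆
      (halfOpenCube d ∩ innerParallel (2 * ε) K) ∪ N := by
    rintro x ⟨hxc, k, hk, hxk⟩
    by_cases hx : x ∈ innerParallel (2 * ε) K
    · exact Or.inl ⟨hxc, hx⟩
    · right
      simp only [innerParallel, Set.mem_ofPred_eq, not_forall] at hx
      obtain ⟨v, hv, hxv⟩ := hx
      exact ⟨hxc, ⟨k, hk, hnear x k (by linarith)⟩, x + v, hxv, hnear x _ (by simpa using hv)⟩
  have hfin : ∀ S : Set (EuclideanSpace ℝ (Fin d)), S ⊆ halfOpenCube d → volume S < ⊤ :=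
    fun S hS => lt_of_le_of_lt (measure_mono hS) (by simp [volume_halfOpenCube])
  have hNle := volume_real_nearBoundary_le (m := M ^ 2) (by positivity) (32 * d) hd hcl hK
  push_cast at hNle
  calc _ ≤ volume.real ((halfOpenCube d ∩ innerParallel (2 * ε) K) ∪ N) :=
        measureReal_mono hsub (measure_union_lt_top (hfin _ Set.inter_subset_left)
          (hfin _ (Set.sep_subset _ _))).ne
    _ ≤ _ := measureReal_union_le _ _
    _ ≤ _ := by gcongr

/-- The compact convex nonempty subsets of the closed unit cube. -/
def IsConvexBodyInCube (K : Set (EuclideanSpace ℝ (Fin d))) : Prop :=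
  K.Nonempty ∧ IsClosed K ∧ Convex ℝ K ∧ K ⊆ closedUnitCube d

/-- The rounded coordinates of the projections of the points of the shell onto `K` are `c`. -/
def HasCode (M : ℕ) (K : Set (EuclideanSpace ℝ (Fin d)))
    (c : shell d M → Fin d → Fin (M ^ 2 + 1)) : Prop :=
  IsConvexBodyInCube K ∧ ∀ g : shell d M, ∃ y, IsProjection K (shellPoint M (g : Fin d → ℤ)) y ∧
    ∀ j, ((c g j : ℕ) : ℝ) ≤ (M : ℝ) ^ 2 * y j ∧ (M : ℝ) ^ 2 * y j < (c g j : ℕ) + 1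

theorem IsConvexBodyInCube.exists_hasCode (M : ℕ) {K : Set (EuclideanSpace ℝ (Fin d))}
    (hK : IsConvexBodyInCube K) : ∃ c, HasCode M K c := by
  have h : ∀ g : shell d M, ∃ y, IsProjection K (shellPoint M (g : Fin d → ℤ)) y := fun g =>
    exists_projection hK.1 hK.2.1 hK.2.2.1 _
  choose y hy using h
  have h0 : ∀ g j, 0 ≤ (M : ℝ) ^ 2 * y g j := fun g j =>
    mul_nonneg (by positivity) (hK.2.2.2 (hy g).1 j).1
  -- Coordinates may equal `1`, so the code takes all `M ^ 2 + 1` values from `0` to `M ^ 2`.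
  refine ⟨fun g j => ⟨⌊(M : ℝ) ^ 2 * y g j⌋₊, ?_⟩, hK, fun g => ⟨y g, hy g, fun j =>
    ⟨Nat.floor_le (h0 g j), Nat.lt_floor_add_one _⟩⟩⟩
  rw [Nat.lt_succ_iff]
  refine Nat.floor_le_of_le ?_
  push_cast
  exact mul_le_of_le_one_right (by positivity) (hK.2.2.2 (hy g).1 j).2

theorem HasCode.dist_le (hd : 0 < d) {M : ℕ} (hM : 16 * d ≤ M ^ 2)
    {K K' : Set (EuclideanSpace ℝ (Fin d))} {c : shell d M → Fin d → Fin (M ^ 2 + 1)}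
    (hK : HasCode M K c) (hK' : HasCode M K' c)
    {z : EuclideanSpace ℝ (Fin d)} (hz : z ∈ K') : ∃ x ∈ K, ‖z - x‖ ≤ 16 * d / (M : ℝ) ^ 2 := by
  refine dist_le_of_projections_near hd hM hK.1.1 hK.1.2.1 hK.1.2.2.1 hK.1.2.2.2 hK'.1.2.2.2
    (fun g hg => ?_) hz
  obtain ⟨y, hy, hyc⟩ := hK.2 ⟨g, hg⟩
  obtain ⟨y', hy', hyc'⟩ := hK'.2 ⟨g, hg⟩
  refine ⟨y, y', hy, hy', fun j => ?_⟩
  have hM' : (0 : ℝ) < (M : ℝ) ^ 2 := by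
    have : 0 < M ^ 2 := by omega
    exact_mod_cast this
  have h1 := hyc j
  have h2 := hyc' j
  rw [le_div_iff₀ hM', mul_comm, ← abs_of_pos hM', ← abs_mul, abs_le]
  constructor <;> linarith [h1.1, h1.2, h2.1, h2.2]

/-- Convex subsets of the unit cube can be bracketed by a small family of pairs of convex sets. -/
theorem exists_convex_brackets (hd : 0 < d) {M : ℕ} (hM : 16 * d ≤ M ^ 2) :
    ∃ (ι : Type) (_ : Fintype ι) (A B : ι → Set (EuclideanSpace ℝ (Fin d))),
      Fintype.card ι ≤ (M ^ 2 + 1) ^ (d * (2 * d * (2 * M + 1) ^ (d - 1))) ∧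
      (∀ i, IsClosed (A i) ∧ Convex ℝ (A i)) ∧ (∀ i, IsClosed (B i) ∧ Convex ℝ (B i)) ∧
      (∀ i, volume.real (halfOpenCube d ∩ B i) ≤ volume.real (halfOpenCube d ∩ A i) +
        2 * d * (d * (2 * (32 * d) + 1) + 1) / (M : ℝ) ^ 2) ∧
      ∀ K : Set (EuclideanSpace ℝ (Fin d)), K.Nonempty → Convex ℝ K → K ⊆ halfOpenCube d →
        ∃ i, A i ⊆ K ∧ K ⊆ B i := by
  classical
  have hM0 : 0 < M := by
    rcases Nat.eq_zero_or_pos M with rfl | h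
    · simp at hM; omega
    · exact h
  have hM' : (0 : ℝ) < (M : ℝ) ^ 2 := by positivity
  have hd' : (0 : ℝ) < d := by exact_mod_cast hd
  -- One body is chosen per realized code; unrealized codes get the empty set, which is harmless.
  let rep : (shell d M → Fin d → Fin (M ^ 2 + 1)) → Set (EuclideanSpace ℝ (Fin d)) := fun c =>
    if h : ∃ K, HasCode M K c then h.choose else ∅
  have hrep : ∀ c, IsCompact (rep c) ∧ Convex ℝ (rep c) := fun c => by
    by_cases h : ∃ K, HasCode M K c
    · simp only [rep, dif_pos h]
      have := h.choose_spec.1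
      exact ⟨isCompact_closedUnitCube.of_isClosed_subset this.2.1 this.2.2.2, this.2.2.1⟩
    · simp only [rep, dif_neg h]
      exact ⟨isCompact_empty, convex_empty⟩
  set ε := 16 * d / (M : ℝ) ^ 2 with hε
  have hε0 : 0 < ε := by positivity
  refine ⟨shell d M → Fin d → Fin (M ^ 2 + 1), inferInstance,
    fun c => innerParallel (2 * ε) (rep c), fun c => outerParallel ε (rep c), ?_,
    fun c => ⟨(hrep c).1.isClosed.innerParallel _, (hrep c).2.innerParallel _⟩,
    fun c => ⟨(hrep c).1.isClosed_outerParallel _, (hrep c).2.outerParallel _⟩,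
    fun c => volume_real_outerParallel_le hd hM0 (hrep c).1.isClosed (hrep c).2, ?_⟩
  · simp only [Fintype.card_fun, Fintype.card_fin, Fintype.card_coe, ← pow_mul]
    exact Nat.pow_le_pow_right (by omega) (by gcongr; exact card_shell_le hM0)
  · intro K hne hK hKc
    obtain ⟨c, hc⟩ := IsConvexBodyInCube.exists_hasCode M
      (⟨hne.closure, isClosed_closure, hK.closure, closure_subset_closedUnitCube hKc⟩ :
        IsConvexBodyInCube (closure K))
    have hex : ∃ K, HasCode M K c := ⟨_, hc⟩
    have hrc : HasCode M (rep c) c := by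
      simp only [rep, dif_pos hex]
      exact hex.choose_spec
    refine ⟨c, innerParallel_subset hne hK hε0 fun z hz => hc.dist_le hd hM hrc hz,
      fun z hz => hrc.dist_le hd hM hc (subset_closure hz)⟩

end ConvexBrackets

/-! ### Concentration for independent random points -/

section RandomSampling

open ProbabilityTheory

theorem HasSubgaussianMGF.mono {Ω : Type*} {mΩ : MeasurableSpace Ω} {μ : Measure Ω} {X : Ω → ℝ}
    {c c' : NNReal} (h : HasSubgaussianMGF X c μ) (hc : c ≤ c') : HasSubgaussianMGF X c' μ :=
  ⟨h.integrable_exp_mul, fun t => (h.mgf_le t).trans (by gcongr)⟩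

theorem indicator_one_mem_Icc {α : Type*} (S : Set α) (x : α) :
    S.indicator (1 : α → ℝ) x ∈ Set.Icc (0 : ℝ) 1 := by
  by_cases h : x ∈ S <;> simp [h]

/-- Hoeffding's inequality for the number of independent random points lying in a set, where only
the points which may lie both inside and outside of the set contribute. -/
theorem measureReal_abs_count_sub_ge_le {ι α : Type*} [Fintype ι] [MeasurableSpace α]
    (μ : ι → Measure α) [∀ i, IsProbabilityMeasure (μ i)] {S : Set α} (hS : MeasurableSet S)
    (D : Finset ι) (hD : ∀ i ∉ D, (∀ᵐ x ∂μ i, x ∈ S) ∨ ∀ᵐ x ∂μ i, x ∉ S)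
    {b : ℝ} (hb : (D.card : ℝ) ≤ b) {t : ℝ} (ht : 0 ≤ t) :
    (Measure.pi μ).real {ω | t ≤ |∑ i, S.indicator (1 : α → ℝ) (ω i) - ∑ i, (μ i).real S|} ≤
      2 * Real.exp (-t ^ 2 / (b / 2)) := by
  classical
  have hb0 : 0 ≤ b := le_trans (by positivity) hb
  have hmeas : Measurable (S.indicator (1 : α → ℝ)) := measurable_one.indicator hS
  have hint : ∀ i, ∫ x, S.indicator (1 : α → ℝ) x ∂μ i = (μ i).real S := fun i =>
    integral_indicator_one hS
  -- Hoeffding's lemma on `[0, 1]` gives the parameter `1 / 4`; an almost surely constant indicator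
  -- has parameter `0`.
  have hsub : ∀ i, HasSubgaussianMGF
      (fun ω : ι → α => S.indicator (1 : α → ℝ) (ω i) - (μ i).real S)
      (if i ∈ D then 1 / 4 else 0) (Measure.pi μ) := fun i => by
    have key : HasSubgaussianMGF (fun x : α => S.indicator (1 : α → ℝ) x - (μ i).real S)
        (if i ∈ D then 1 / 4 else 0) (μ i) := by
      rw [← hint i]
      by_cases hi : i ∈ D
      · rw [if_pos hi]
        convert! hasSubgaussianMGF_of_mem_Icc (μ := μ i) hmeas.aemeasurable
          (ae_of_all _ (indicator_one_mem_Icc S)) using 1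
        norm_num
      · rw [if_neg hi]
        rcases hD i hi with h | h
        · have h' : ∀ᵐ x ∂μ i, S.indicator (1 : α → ℝ) x ∈ Set.Icc (1 : ℝ) 1 := by
            filter_upwards [h] with x hx
            simp [hx]
          simpa using hasSubgaussianMGF_of_mem_Icc hmeas.aemeasurable h'
        · have h' : ∀ᵐ x ∂μ i, S.indicator (1 : α → ℝ) x ∈ Set.Icc (0 : ℝ) 0 := by
            filter_upwards [h] with x hx
            simp [hx]
          simpa using hasSubgaussianMGF_of_mem_Icc hmeas.aemeasurable h'
    exact HasSubgaussianMGF.of_map (Y := Function.eval i) (μ := Measure.pi μ)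
      (measurable_pi_apply i).aemeasurable (by rwa [(measurePreserving_eval μ i).map_eq])
  have hind : iIndepFun (fun i (ω : ι → α) => S.indicator (1 : α → ℝ) (ω i) - (μ i).real S)
      (Measure.pi μ) :=
    iIndepFun_pi (X := fun i x => S.indicator (1 : α → ℝ) x - (μ i).real S)
      fun i => (hmeas.sub_const _).aemeasurable
  have hsum := HasSubgaussianMGF.sum_of_iIndepFun hind (s := Finset.univ) fun i _ => hsub i
  have hc : (∑ i : ι, if i ∈ D then (1 / 4 : NNReal) else 0) ≤ (b / 4).toNNReal := by
    rw [Finset.sum_ite_mem, Finset.univ_inter, Finset.sum_const, nsmul_eq_mul,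
      ← NNReal.coe_le_coe, Real.coe_toNNReal _ (by positivity)]
    push_cast
    linarith
  have hsum' := HasSubgaussianMGF.mono hsum hc
  have h1 := hsum'.measure_ge_le ht
  have h2 := hsum'.neg.measure_ge_le ht
  have hcoe : (2 : ℝ) * ((b / 4).toNNReal : ℝ) = b / 2 := by
    rw [Real.coe_toNNReal _ (by positivity)]; ring
  rw [hcoe] at h1 h2
  have hset : {ω : ι → α | t ≤ |∑ i, S.indicator (1 : α → ℝ) (ω i) - ∑ i, (μ i).real S|} ⊆
      {ω | t ≤ ∑ i, (S.indicator (1 : α → ℝ) (ω i) - (μ i).real S)} ∪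
      {ω | t ≤ (-fun ω : ι → α => ∑ i, (S.indicator (1 : α → ℝ) (ω i) - (μ i).real S)) ω} := by
    intro ω hω
    simp only [Set.mem_ofPred_eq, ← Finset.sum_sub_distrib] at hω
    rcases le_abs.1 hω with h | h
    · exact Or.inl h
    · exact Or.inr h
  calc _ ≤ _ := measureReal_mono hset
    _ ≤ _ := measureReal_union_le _ _
    _ ≤ _ := by linarith

/-- Atomless sampling makes the points distinct, so the sample has exactly the prescribed
cardinality. -/
theorem ae_injective_pi {ι α : Type*} [Fintype ι] [MeasurableSpace α] [MeasurableEq α]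
    [MeasurableSingletonClass α]
    (μ : ι → Measure α) [∀ i, IsProbabilityMeasure (μ i)] [∀ i, NullSingletonClass (μ i)] :
    ∀ᵐ ω ∂Measure.pi μ, Function.Injective ω := by
  have h : ∀ i j, i ≠ j → ∀ᵐ ω ∂Measure.pi μ, ω i ≠ ω j := fun i j hij => by
    have hind : IndepFun (fun ω : ι → α => ω i) (fun ω => ω j) (Measure.pi μ) :=
      (iIndepFun_pi (μ := μ) (X := fun _ x => x) fun i => aemeasurable_id).indepFun hij
    rw [indepFun_iff_map_prod_eq_prod_map_map (measurable_pi_apply i).aemeasurable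
      (measurable_pi_apply j).aemeasurable] at hind
    have e1 : Measure.map (fun ω : ι → α => ω i) (Measure.pi μ) = μ i :=
      (measurePreserving_eval μ i).map_eq
    have e2 : Measure.map (fun ω : ι → α => ω j) (Measure.pi μ) = μ j :=
      (measurePreserving_eval μ j).map_eq
    rw [e1, e2] at hind
    have hnull : ((μ i).prod (μ j)) {p | p.1 = p.2} = 0 := by
      rw [Measure.measure_prod_null (measurableSet_eq_fun measurable_fst measurable_snd)]
      refine ae_of_all _ fun x => ?_
      have : Prod.mk x ⁻¹' {p : α × α | p.1 = p.2} = {x} := by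
        ext y; simp [eq_comm]
      simp [this]
    rw [ae_iff]
    rw [← hind, Measure.map_apply (by fun_prop)
      (measurableSet_eq_fun measurable_fst measurable_snd)] at hnull
    simpa using hnull
  have h' : ∀ᵐ ω ∂Measure.pi μ, ∀ i j, i ≠ j → ω i ≠ ω j := by
    simp only [ae_all_iff]
    exact h
  filter_upwards [h'] with ω hω i j hij
  by_contra hne
  exact hω i j hne hij

theorem ncard_inter_range_eq_sum_indicator {ι α : Type*} [Fintype ι] {ω : ι → α}
    (hω : Function.Injective ω) (S : Set α) :
    ((S ∩ Set.range ω).ncard : ℝ) = ∑ i, S.indicator (1 : α → ℝ) (ω i) := by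
  classical
  have h1 : S ∩ Set.range ω = ω '' (Finset.univ.filter fun i => ω i ∈ S : Finset ι) := by
    ext x
    simp only [Set.mem_inter_iff, Set.mem_range, Finset.coe_filter, Finset.mem_univ, true_and,
      Set.mem_image, Set.mem_ofPred_eq]
    constructor
    · rintro ⟨hx, i, rfl⟩
      exact ⟨i, hx, rfl⟩
    · rintro ⟨i, hi, rfl⟩
      exact ⟨hi, i, rfl⟩
  rw [h1, Set.ncard_image_of_injective _ hω, Set.ncard_coe_finset]
  simp [Set.indicator_apply]

/-- A point set with small deviation for a finite family of sets. -/
theorem exists_sample {ι α J : Type*} [Fintype ι] [Fintype J] [MeasurableSpace α]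
    [MeasurableEq α] [MeasurableSingletonClass α]
    (μ : ι → Measure α) [∀ i, IsProbabilityMeasure (μ i)] [∀ i, NullSingletonClass (μ i)]
    {R : ι → Set α} (hR : ∀ i, ∀ᵐ x ∂μ i, x ∈ R i)
    {S : J → Set α} (hS : ∀ j, MeasurableSet (S j))
    (D : J → Finset ι) (hD : ∀ j, ∀ i ∉ D j, (∀ᵐ x ∂μ i, x ∈ S j) ∨ ∀ᵐ x ∂μ i, x ∉ S j)
    {b : ℝ} (hb : ∀ j, ((D j).card : ℝ) ≤ b) {t : ℝ} (ht : 0 ≤ t)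
    (hlt : Fintype.card J * (2 * Real.exp (-t ^ 2 / (b / 2))) < 1) :
    ∃ ω : ι → α, Function.Injective ω ∧ (∀ i, ω i ∈ R i) ∧
      ∀ j, |((S j ∩ Set.range ω).ncard : ℝ) - ∑ i, (μ i).real (S j)| ≤ t := by
  set bad : Set (ι → α) := ⋃ j : J,
    {ω | t ≤ |∑ i, (S j).indicator (1 : α → ℝ) (ω i) - ∑ i, (μ i).real (S j)|} with hbad
  have hmeas : ∀ j, Measurable ((S j).indicator (1 : α → ℝ)) := fun j =>
    measurable_one.indicator (hS j)
  have hbadm : MeasurableSet bad := by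
    refine MeasurableSet.iUnion fun j => measurableSet_le measurable_const ?_
    have : Measurable fun ω : ι → α => ∑ i, (S j).indicator (1 : α → ℝ) (ω i) :=
      Finset.measurable_sum _ fun i _ => (hmeas j).comp (measurable_pi_apply i)
    fun_prop
  have hbad1 : (Measure.pi μ).real bad < 1 := by
    refine lt_of_le_of_lt ?_ hlt
    refine (measureReal_iUnion_fintype_le _).trans ?_
    refine (Finset.sum_le_card_nsmul _ _ _ fun j _ =>
      measureReal_abs_count_sub_ge_le μ (hS j) (D j) (hD j) (hb j) ht).trans ?_
    rw [nsmul_eq_mul, Finset.card_univ]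
  have hRae : ∀ᵐ ω ∂Measure.pi μ, ∀ i, ω i ∈ R i := by
    rw [ae_all_iff]
    intro i
    have h1 := hR i
    rw [← (measurePreserving_eval μ i).map_eq] at h1
    exact ae_of_ae_map (measurable_pi_apply i).aemeasurable h1
  have hgood : ∃ ω, ω ∉ bad ∧ Function.Injective ω ∧ ∀ i, ω i ∈ R i := by
    by_contra hcon
    push Not at hcon
    have hall : ∀ᵐ ω ∂Measure.pi μ, ω ∈ bad := by
      filter_upwards [ae_injective_pi μ, hRae] with ω h1 h2
      by_contra h3
      obtain ⟨i, hi⟩ := hcon ω h3 h1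
      exact hi (h2 i)
    have : (Measure.pi μ).real bad = 1 := by
      rw [Measure.real, (mem_ae_iff_prob_eq_one hbadm).1 hall]
      simp
    linarith
  obtain ⟨ω, hω, hinj, hmem⟩ := hgood
  refine ⟨ω, hinj, hmem, fun j => ?_⟩
  rw [ncard_inter_range_eq_sum_indicator hinj]
  simp only [hbad, Set.mem_iUnion, not_exists, Set.mem_ofPred_eq, not_le] at hω
  exact (hω j).le

end RandomSampling

/-! ### Stratified sampling of the cube -/

section StratifiedSampling

open ProbabilityTheory

variable {d : ℕ}

/-- The regions from which the sample points are drawn: all cells of a grid, and the whole cube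
a certain number of times. -/
def sampleRegion (d k r : ℕ) : (Fin d → Fin k) ⊕ Fin r → Set (EuclideanSpace ℝ (Fin d)) :=
  Sum.elim (gridCell k) fun _ => halfOpenCube d

theorem measurableSet_sampleRegion (k r : ℕ) (i : (Fin d → Fin k) ⊕ Fin r) :
    MeasurableSet (sampleRegion d k r i) := by
  rcases i with a | j
  · exact measurableSet_gridCell k a
  · exact measurableSet_halfOpenCube

theorem sampleRegion_subset {k : ℕ} (hk : 0 < k) (r : ℕ) (i : (Fin d → Fin k) ⊕ Fin r) :
    sampleRegion d k r i ⊆ halfOpenCube d := by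
  rcases i with a | j
  · exact fun x hx => mem_gridCell_halfOpenCube hk hx
  · exact subset_rfl

theorem volume_sampleRegion_ne_zero {k : ℕ} (hk : 0 < k) (r : ℕ) (i : (Fin d → Fin k) ⊕ Fin r) :
    volume (sampleRegion d k r i) ≠ 0 := by
  rcases i with a | j
  · rw [sampleRegion, Sum.elim_inl, volume_gridCell hk]
    have : (0 : ℝ) < (1 / (k : ℝ)) ^ d := by positivity
    simpa using this
  · rw [sampleRegion, Sum.elim_inr, volume_halfOpenCube]
    exact one_ne_zero

theorem sum_volume_real_gridCell_inter {k : ℕ} (hk : 0 < k) {S : Set (EuclideanSpace ℝ (Fin d))}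
    (hS : MeasurableSet S) :
    ∑ a : Fin d → Fin k, volume.real (gridCell k a ∩ S) = volume.real (halfOpenCube d ∩ S) := by
  have hU : halfOpenCube d ∩ S = ⋃ a : Fin d → Fin k, gridCell k a ∩ S := by
    ext x
    simp only [Set.mem_inter_iff, Set.mem_iUnion]
    constructor
    · rintro ⟨hx, hxS⟩
      obtain ⟨a, ha⟩ := exists_mem_gridCell hk hx
      exact ⟨a, ha, hxS⟩
    · rintro ⟨a, ha, hxS⟩
      exact ⟨mem_gridCell_halfOpenCube hk ha, hxS⟩
  rw [hU, measureReal_iUnion_fintype (h' := fun a => (lt_of_le_of_lt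
    (measure_mono Set.inter_subset_left) (by simp [volume_gridCell hk])).ne)]
  · intro a b hab
    refine Set.disjoint_left.2 fun x hxa hxb => hab (gridCell_injective hxa.1 hxb.1)
  · exact fun a => (measurableSet_gridCell k a).inter hS

/-- The scheme is unbiased: equal cells with one point each contribute `k ^ d` times the volume, and
each extra uniform point contributes it once. -/
theorem sum_cond_sampleRegion_real {k : ℕ} (hk : 0 < k) (r : ℕ)
    {S : Set (EuclideanSpace ℝ (Fin d))} (hS : MeasurableSet S) :
    ∑ i, (volume[|sampleRegion d k r i]).real S =
      ((k ^ d + r : ℕ) : ℝ) * volume.real (halfOpenCube d ∩ S) := by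
  have hk' : (0 : ℝ) < k := by exact_mod_cast hk
  have h1 : ∀ a : Fin d → Fin k, (volume[|gridCell k a]).real S =
      (k : ℝ) ^ d * volume.real (gridCell k a ∩ S) := fun a => by
    rw [Measure.real, cond_apply (measurableSet_gridCell k a), ENNReal.toReal_mul,
      ENNReal.toReal_inv, volume_gridCell hk, ENNReal.toReal_ofReal (by positivity), Measure.real,
      one_div, inv_pow, inv_inv]
  have h2 : (volume[|halfOpenCube d]).real S = volume.real (halfOpenCube d ∩ S) := by
    rw [Measure.real, cond_apply measurableSet_halfOpenCube, volume_halfOpenCube, inv_one, one_mul,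
      Measure.real]
  rw [Fintype.sum_sum_type]
  simp only [sampleRegion, Sum.elim_inl, Sum.elim_inr, h1, h2, ← Finset.mul_sum,
    sum_volume_real_gridCell_inter hk hS, Finset.sum_const, Finset.card_univ, Fintype.card_fin,
    nsmul_eq_mul]
  push_cast
  ring

/-- A point set in the unit cube whose discrepancy is small for a given finite family of closed
convex sets. -/
theorem exists_finset_small_deviation (hd : 0 < d) {k : ℕ} (hk : 0 < k) (r : ℕ) {J : Type*}
    [Fintype J] {S : J → Set (EuclideanSpace ℝ (Fin d))}
    (hS : ∀ j, IsClosed (S j) ∧ Convex ℝ (S j)) {t : ℝ} (ht : 0 ≤ t)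
    (hlt : Fintype.card J * (2 * Real.exp (-t ^ 2 /
      ((2 * d * (d * 3 + 1) * (k : ℝ) ^ (d - 1) + r) / 2))) < 1) :
    ∃ P : Finset (EuclideanSpace ℝ (Fin d)), P.card = k ^ d + r ∧ ↑P ⊆ halfOpenCube d ∧
      ∀ j, |((S j ∩ P).ncard : ℝ) - ((k ^ d + r : ℕ) : ℝ) * volume.real (halfOpenCube d ∩ S j)|
        ≤ t := by
  classical
  have hprob : ∀ i, IsProbabilityMeasure (volume[|sampleRegion d k r i]) := fun i =>
    cond_isProbabilityMeasure_of_finite (volume_sampleRegion_ne_zero hk r i)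
      (lt_of_le_of_lt (measure_mono (sampleRegion_subset hk r i))
        (by simp [volume_halfOpenCube])).ne
  have : Nonempty (Fin d) := ⟨⟨0, hd⟩⟩
  have hnull : ∀ i, NullSingletonClass (volume[|sampleRegion d k r i]) := fun i =>
    ⟨fun x => by
      rw [cond_apply (measurableSet_sampleRegion k r i),
        measure_mono_null Set.inter_subset_right (measure_singleton x), mul_zero]⟩
  -- The indices whose points may fall on either side of `S j`. Points of one cell differ by at most
  -- one mesh, so `ρ = 1` catches every cell meeting both `S j` and its complement.
  let D : J → Finset ((Fin d → Fin k) ⊕ Fin r) := fun j =>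
    (Finset.univ.filter fun a : Fin d → Fin k => NearBoundary k 1 (S j) a).disjSum Finset.univ
  have hcell : ∀ (a : Fin d → Fin k) (x y : EuclideanSpace ℝ (Fin d)), x ∈ gridCell k a →
      y ∈ gridCell k a → GridNear k 1 x y := fun a x y hx hy j => by
    have h1 := hx j
    have h2 := hy j
    rw [abs_le]
    push_cast
    constructor <;> linarith [h1.1, h1.2, h2.1, h2.2]
  have hD : ∀ j, ∀ i ∉ D j, (∀ᵐ x ∂volume[|sampleRegion d k r i], x ∈ S j) ∨
      ∀ᵐ x ∂volume[|sampleRegion d k r i], x ∉ S j := by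
    intro j i hi
    rcases i with a | l
    · have hnb : ¬ NearBoundary k 1 (S j) a := by simpa [D] using hi
      have hae := ae_cond_mem (μ := volume) (measurableSet_sampleRegion k r (.inl a))
      by_cases hex : ∃ x ∈ gridCell k a, x ∈ S j
      · obtain ⟨x, hx, hxS⟩ := hex
        left
        filter_upwards [hae] with y hy
        by_contra hyS
        exact hnb ⟨x, hx, ⟨x, hxS, hcell a x x hx hx⟩, y, hyS, hcell a x y hx hy⟩
      · right
        filter_upwards [hae] with y hy hyS
        exact hex ⟨y, hy, hyS⟩
    · simp [D] at hi
  have hb : ∀ j, ((D j).card : ℝ) ≤ 2 * d * (d * 3 + 1) * (k : ℝ) ^ (d - 1) + r := by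
    intro j
    have h1 := card_nearBoundary_le k 1 (hS j).1 (hS j).2
    have h2 : ((D j).card : ℝ) = ((Finset.univ.filter fun a : Fin d → Fin k =>
        NearBoundary k 1 (S j) a).card : ℝ) + r := by
      simp [D, Finset.card_disjSum]
    rw [h2]
    gcongr
    exact_mod_cast h1
  obtain ⟨ω, hinj, hmem, hdev⟩ := exists_sample (fun i => volume[|sampleRegion d k r i])
    (R := sampleRegion d k r) (fun i => ae_cond_mem (measurableSet_sampleRegion k r i))
    (S := S) (fun j => (hS j).1.measurableSet) D hD
    (b := 2 * d * (d * 3 + 1) * (k : ℝ) ^ (d - 1) + r) hb ht hlt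
  refine ⟨Finset.univ.map ⟨ω, hinj⟩, ?_, ?_, fun j => ?_⟩
  · simp
  · intro x hx
    simp only [Finset.coe_map, Function.Embedding.coeFn_mk, Finset.coe_univ, Set.image_univ,
      Set.mem_range] at hx
    obtain ⟨i, rfl⟩ := hx
    exact sampleRegion_subset hk r i (hmem i)
  · have := hdev j
    rw [sum_cond_sampleRegion_real hk r (hS j).1.measurableSet] at this
    simpa using this

theorem minimalIsotropicDiscrepancy_le_of_finset {n : ℕ} {P : Finset (EuclideanSpace ℝ (Fin d))}
    (hn : P.card = n) (hP : ↑P ⊆ halfOpenCube d) :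
    minimalIsotropicDiscrepancy d n ≤ isotropicDiscrepancy (P : Set (EuclideanSpace ℝ (Fin d))) := by
  exact ciInf_le (f := fun P : {P : Finset (EuclideanSpace ℝ (Fin d)) //
      P.card = n ∧ ↑P ⊆ halfOpenCube d} =>
      isotropicDiscrepancy (P.1 : Set (EuclideanSpace ℝ (Fin d))))
    ⟨0, by rintro _ ⟨Q, rfl⟩; exact isotropicDiscrepancy_nonneg _⟩ ⟨P, hn, hP⟩

theorem minimalIsotropicDiscrepancy_nonneg (d n : ℕ) : 0 ≤ minimalIsotropicDiscrepancy d n :=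
  Real.iInf_nonneg fun _ => isotropicDiscrepancy_nonneg _

/-- Upper bound for the minimal isotropic discrepancy through stratified random sampling and
bracketing. -/
theorem minimalIsotropicDiscrepancy_le (hd : 0 < d) {k : ℕ} (hk : 0 < k) (r : ℕ) {M : ℕ}
    (hM : 16 * d ≤ M ^ 2) {t : ℝ} (ht : 0 ≤ t)
    (hlt : 4 * ((M : ℝ) ^ 2 + 1) ^ (d * (2 * d * (2 * M + 1) ^ (d - 1))) * Real.exp (-t ^ 2 /
      ((2 * d * (d * 3 + 1) * (k : ℝ) ^ (d - 1) + r) / 2)) < 1) :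
    minimalIsotropicDiscrepancy d (k ^ d + r) ≤
      t / (k ^ d + r : ℕ) + 2 * d * (d * (2 * (32 * d) + 1) + 1) / (M : ℝ) ^ 2 := by
  obtain ⟨ι, _, A, B, hcard, hA, hB, hvol, hbr⟩ := exists_convex_brackets hd hM
  set n := k ^ d + r with hn
  have hn0 : 0 < n := by positivity
  have hn' : (0 : ℝ) < n := by exact_mod_cast hn0
  set δ := 2 * d * (d * (2 * (32 * d) + 1) + 1) / (M : ℝ) ^ 2 with hδ
  -- Inner and outer brackets are controlled together, which doubles the family; with the two-sided
  -- tail this accounts for the factor `4`.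
  obtain ⟨P, hPc, hP, hdev⟩ := exists_finset_small_deviation hd hk r (J := ι ⊕ ι)
    (S := Sum.elim A B) (fun j => by
      rcases j with i | i
      · exact hA i
      · exact hB i) ht (by
      refine lt_of_le_of_lt ?_ hlt
      have h1 : (Fintype.card ι : ℝ) ≤
          ((M : ℝ) ^ 2 + 1) ^ (d * (2 * d * (2 * M + 1) ^ (d - 1))) := by exact_mod_cast hcard
      rw [Fintype.card_sum]
      push_cast
      rw [← mul_assoc]
      refine mul_le_mul_of_nonneg_right ?_ (Real.exp_pos _).le
      linarith)
  refine (minimalIsotropicDiscrepancy_le_of_finset hPc hP).trans ?_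
  have : Nonempty {K : Set (EuclideanSpace ℝ (Fin d)) // Convex ℝ K ∧ K ⊆ halfOpenCube d} :=
    ⟨⟨∅, convex_empty, Set.empty_subset _⟩⟩
  refine ciSup_le ?_
  rintro ⟨K, hK, hKc⟩
  have hrhs : 0 ≤ t / n + δ := by positivity
  rcases K.eq_empty_or_nonempty with rfl | hne
  · simpa using hrhs
  obtain ⟨i, hAK, hKB⟩ := hbr K hne hK hKc
  have hfin : ∀ S : Set (EuclideanSpace ℝ (Fin d)), S ⊆ halfOpenCube d → volume S ≠ ⊤ :=
    fun S hS => (lt_of_le_of_lt (measure_mono hS) (by simp [volume_halfOpenCube])).ne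
  have v1 : volume.real (halfOpenCube d ∩ A i) ≤ volume.real K :=
    measureReal_mono (Set.inter_subset_right.trans hAK) (hfin K hKc)
  have v2 : volume.real K ≤ volume.real (halfOpenCube d ∩ B i) :=
    measureReal_mono (Set.subset_inter hKc hKB) (hfin _ Set.inter_subset_left)
  have c1 : ((A i ∩ P).ncard : ℝ) ≤ ((K ∩ P).ncard : ℝ) := by
    exact_mod_cast Set.ncard_le_ncard (Set.inter_subset_inter_left _ hAK)
      (P.finite_toSet.subset Set.inter_subset_right)
  have c2 : ((K ∩ P).ncard : ℝ) ≤ ((B i ∩ P).ncard : ℝ) := by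
    exact_mod_cast Set.ncard_le_ncard (Set.inter_subset_inter_left _ hKB)
      (P.finite_toSet.subset Set.inter_subset_right)
  have d1 := abs_le.1 (hdev (.inl i))
  have d2 := abs_le.1 (hdev (.inr i))
  simp only [Sum.elim_inl, Sum.elim_inr] at d1 d2
  have hv := hvol i
  rw [← hn] at d1 d2
  have hcardP : ((P : Set (EuclideanSpace ℝ (Fin d))).ncard : ℝ) = n := by
    rw [Set.ncard_coe_finset, hPc]
  change |((K ∩ P).ncard : ℝ) / ((P : Set (EuclideanSpace ℝ (Fin d))).ncard : ℝ) -
    volume.real K| ≤ t / n + δ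
  rw [hcardP]
  have e1 : ((K ∩ P).ncard : ℝ) / n - volume.real K =
      (((K ∩ P).ncard : ℝ) - n * volume.real K) / n := by field_simp
  have e2 : t / n + δ = (t + n * δ) / n := by field_simp
  rw [e1, e2, abs_div, abs_of_pos hn']
  gcongr
  rw [abs_le]
  constructor <;> nlinarith

end StratifiedSampling

/-! ### Choice of parameters and comparison of rates -/

section Asymptotics

open Filter

/-- Bounds the remainder `r` when `n` lies between consecutive `d`-th powers: it has the same order
`k ^ (d - 1)` as the number of boundary cells. -/
theorem succ_pow_le_add (k d : ℕ) (hk : 0 < k) : (k + 1) ^ d ≤ k ^ d + 3 ^ d * k ^ (d - 1) := by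
  induction d with
  | zero => simp
  | succ e ih =>
    rw [Nat.add_sub_cancel]
    have h1 : k ^ (e - 1) ≤ k ^ e := Nat.pow_le_pow_right hk (by omega)
    have h2 : k * k ^ (e - 1) ≤ k ^ e ∨ e = 0 := by
      rcases Nat.eq_zero_or_pos e with rfl | he
      · exact Or.inr rfl
      · left
        rw [← pow_succ', Nat.sub_add_cancel he]
    rcases h2 with h2 | rfl
    · calc (k + 1) ^ (e + 1) = (k + 1) * (k + 1) ^ e := by ring
        _ ≤ (k + 1) * (k ^ e + 3 ^ e * k ^ (e - 1)) := by gcongr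
        _ = k ^ (e + 1) + k ^ e + 3 ^ e * (k * k ^ (e - 1)) + 3 ^ e * k ^ (e - 1) := by ring
        _ ≤ k ^ (e + 1) + 3 ^ e * k ^ e + 3 ^ e * k ^ e + 3 ^ e * k ^ e := by
          gcongr
          exact Nat.le_mul_of_pos_left _ (by positivity)
        _ = _ := by ring
    · simp

theorem exists_pow_le_lt_succ_pow (n d : ℕ) (hd : 0 < d) :
    ∃ k : ℕ, k ^ d ≤ n ∧ n < (k + 1) ^ d := by
  classical
  have hex : ∃ k : ℕ, n < (k + 1) ^ d := ⟨n, lt_of_lt_of_le (Nat.lt_succ_self n)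
    (Nat.le_self_pow hd.ne' _)⟩
  refine ⟨Nat.find hex, ?_, Nat.find_spec hex⟩
  rcases h : Nat.find hex with _ | j
  · simp [hd.ne']
  · have := Nat.find_min hex (m := j) (by omega)
    omega

theorem eventually_log_lt (A c : ℝ) (hA : 0 < A) (hc : 0 < c) :
    ∀ᶠ M : ℕ in atTop, 2 + A * Real.log ((M : ℝ) ^ 2 + 1) < c * M := by
  have h1 : ∀ᶠ x : ℝ in atTop, ‖Real.log x‖ ≤ c / (8 * A) * ‖id x‖ :=
    Real.isLittleO_log_id_atTop.bound (by positivity)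
  have h2 : ∀ᶠ x : ℝ in atTop, 2 * (2 + A) / c < x := eventually_gt_atTop _
  have h3 : ∀ᶠ x : ℝ in atTop, 1 ≤ x := eventually_ge_atTop _
  filter_upwards [tendsto_natCast_atTop_atTop.eventually h1,
    tendsto_natCast_atTop_atTop.eventually h2, tendsto_natCast_atTop_atTop.eventually h3]
    with M e1 e2 e3
  have hM0 : (0 : ℝ) < M := by linarith
  have hlog : Real.log ((M : ℝ) ^ 2 + 1) ≤ 1 + 2 * Real.log M := by
    calc Real.log ((M : ℝ) ^ 2 + 1) ≤ Real.log (2 * (M : ℝ) ^ 2) :=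
          Real.log_le_log (by positivity) (by nlinarith)
      _ = Real.log 2 + 2 * Real.log M := by
          rw [Real.log_mul (by norm_num) (by positivity), Real.log_pow]; norm_num
      _ ≤ 1 + 2 * Real.log M := by
          have := Real.log_two_lt_d9; linarith
  have hlogM : Real.log M ≤ c / (8 * A) * M := by
    have h := (le_abs_self _).trans e1
    simpa using h
  have h4 : A * Real.log ((M : ℝ) ^ 2 + 1) ≤ A + 2 * (A * (c / (8 * A) * M)) := by
    have : A * Real.log M ≤ A * (c / (8 * A) * M) := by gcongr
    nlinarith
  have h5 : A * (c / (8 * A) * M) = c * M / 8 := by field_simp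
  rw [div_lt_iff₀ hc] at e2
  rw [h5] at h4
  nlinarith

/-- The number of brackets is beaten by the tail bound. -/
theorem eventually_brackets_mul_exp_lt_one {d : ℕ} (hd : 2 ≤ d) {c : ℝ} (hc : 0 < c) :
    ∀ᶠ M : ℕ in atTop, 4 * ((M : ℝ) ^ 2 + 1) ^ (d * (2 * d * (2 * M + 1) ^ (d - 1))) *
      Real.exp (-(c * (M : ℝ) ^ (2 * (d - 1)))) < 1 := by
  filter_upwards [eventually_log_lt (2 * d * d * 3 ^ (d - 1)) c (by positivity) hc,
    eventually_ge_atTop 1] with M hM hM1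
  have hM1' : (1 : ℝ) ≤ M := by exact_mod_cast hM1
  have hlog0 : 0 ≤ Real.log ((M : ℝ) ^ 2 + 1) := Real.log_nonneg (by nlinarith)
  have hpow1 : (1 : ℝ) ≤ (M : ℝ) ^ (d - 1) := one_le_pow₀ hM1'
  -- The place where `d ≥ 2` enters: after cancelling one factor `M ^ (d - 1)`, the other must still
  -- dominate a logarithm.
  have hpow2 : (M : ℝ) ≤ (M : ℝ) ^ (d - 1) := le_self_pow₀ hM1' (by omega)
  have hE : ((d * (2 * d * (2 * M + 1) ^ (d - 1)) : ℕ) : ℝ) ≤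
      2 * d * d * 3 ^ (d - 1) * (M : ℝ) ^ (d - 1) := by
    push_cast
    have : (2 * (M : ℝ) + 1) ^ (d - 1) ≤ 3 ^ (d - 1) * (M : ℝ) ^ (d - 1) := by
      rw [← mul_pow]
      gcongr
      linarith
    calc (d : ℝ) * (2 * d * (2 * M + 1) ^ (d - 1)) ≤
        d * (2 * d * (3 ^ (d - 1) * (M : ℝ) ^ (d - 1))) := by gcongr
      _ = _ := by ring
  set E := d * (2 * d * (2 * M + 1) ^ (d - 1)) with hEdef
  have h4 : (4 : ℝ) = Real.exp (Real.log 4) := (Real.exp_log (by norm_num)).symm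
  have h5 : ((M : ℝ) ^ 2 + 1) ^ E = Real.exp (E * Real.log ((M : ℝ) ^ 2 + 1)) := by
    rw [Real.exp_nat_mul, Real.exp_log (by positivity)]
  rw [h4, h5, ← Real.exp_add, ← Real.exp_add, Real.exp_lt_one_iff]
  have hlog4 : Real.log 4 ≤ 2 := by
    have : Real.log 4 = 2 * Real.log 2 := by
      rw [show (4 : ℝ) = 2 ^ 2 by norm_num, Real.log_pow]; norm_num
    have := Real.log_two_lt_d9
    linarith
  have h6 : (E : ℝ) * Real.log ((M : ℝ) ^ 2 + 1) ≤
      2 * d * d * 3 ^ (d - 1) * (M : ℝ) ^ (d - 1) * Real.log ((M : ℝ) ^ 2 + 1) := by gcongr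
  have h7 : (M : ℝ) ^ (2 * (d - 1)) = (M : ℝ) ^ (d - 1) * (M : ℝ) ^ (d - 1) := by
    rw [two_mul, pow_add]
  have h8 : (M : ℝ) ^ (d - 1) * (2 + 2 * d * d * 3 ^ (d - 1) * Real.log ((M : ℝ) ^ 2 + 1)) <
      (M : ℝ) ^ (d - 1) * (c * (M : ℝ) ^ (d - 1)) := by
    refine mul_lt_mul_of_pos_left (hM.trans_le ?_) (by linarith)
    gcongr
  rw [h7]
  nlinarith

/-- The minimal isotropic discrepancy is of smaller order than `n ^ (-1 / d)`. -/
theorem exists_minimalIsotropicDiscrepancy_le {d : ℕ} (hd : 2 ≤ d) {ε : ℝ} (hε : 0 < ε) :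
    ∃ N : ℕ, ∀ n, N ≤ n →
      minimalIsotropicDiscrepancy d n ≤ ε / (n : ℝ) ^ (1 / (d : ℝ)) := by
  have hd0 : 0 < d := by omega
  have hd' : (0 : ℝ) < d := by exact_mod_cast hd0
  set Cd : ℝ := 2 * d * (d * (2 * (32 * d) + 1) + 1) with hCd
  have hCd0 : 0 < Cd := by positivity
  -- Sampling contributes `θ / k` and bracketing `Cd * θ / k`, in total `ε / (2 * k)`; the `2` pays
  -- for `n ^ (1 / d) ≤ k + 1 ≤ 2 * k`.
  set θ : ℝ := ε / (2 * (1 + Cd)) with hθ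
  have hθ0 : 0 < θ := by positivity
  set β : ℝ := 2 * d * (d * 3 + 1) + 3 ^ d with hβ
  have hβ0 : 0 < β := by positivity
  -- At most `β * k ^ (d - 1)` points are undecided, so Hoeffding's exponent is at least `2 * θ ^ 2
  -- / β * k ^ (d - 1)`; then `k ≥ θ / 4 * M ^ 2` is inserted.
  set c : ℝ := 2 * θ ^ 2 / β * (θ / 4) ^ (d - 1) with hc
  have hc0 : 0 < c := by positivity
  obtain ⟨M₀, hM₀⟩ := eventually_atTop.1 (eventually_brackets_mul_exp_lt_one hd hc0)
  set M₁ : ℕ := max M₀ (16 * d) with hM₁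
  set k₀ : ℕ := ⌈θ * (M₁ : ℝ) ^ 2⌉₊ + 1 with hk₀
  refine ⟨(k₀ + 1) ^ d, fun n hn => ?_⟩
  obtain ⟨k, hkn, hnk⟩ := exists_pow_le_lt_succ_pow n d hd0
  have hkk₀ : k₀ ≤ k := by
    by_contra hcon
    push Not at hcon
    have : (k + 1) ^ d ≤ (k₀ + 1) ^ d := by gcongr
    omega
  have hk : 0 < k := by omega
  have hk' : (0 : ℝ) < k := by exact_mod_cast hk
  obtain ⟨r, rfl⟩ : ∃ r, n = k ^ d + r := ⟨n - k ^ d, by omega⟩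
  have hr : (r : ℝ) ≤ 3 ^ d * (k : ℝ) ^ (d - 1) := by
    have h1 := succ_pow_le_add k d hk
    have h2 : r ≤ 3 ^ d * k ^ (d - 1) := by omega
    exact_mod_cast h2
  -- The least `M` with `M ^ 2 ≥ k / θ`, so that `Cd / M ^ 2 ≤ Cd * θ / k`.
  set M : ℕ := ⌈Real.sqrt (k / θ)⌉₊ with hM
  have hMge : Real.sqrt (k / θ) ≤ M := Nat.le_ceil _
  have hMlt : (M : ℝ) < Real.sqrt (k / θ) + 1 := Nat.ceil_lt_add_one (Real.sqrt_nonneg _)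
  have hMsq : (k : ℝ) / θ ≤ (M : ℝ) ^ 2 := (Real.sqrt_le_left (by positivity)).1 hMge
  have hkθ : (M₁ : ℝ) ^ 2 ≤ k / θ := by
    rw [le_div_iff₀ hθ0]
    have h1 : θ * (M₁ : ℝ) ^ 2 ≤ (⌈θ * (M₁ : ℝ) ^ 2⌉₊ : ℝ) := Nat.le_ceil _
    have h2 : ((⌈θ * (M₁ : ℝ) ^ 2⌉₊ : ℕ) : ℝ) ≤ k := by
      exact_mod_cast (by omega : ⌈θ * (M₁ : ℝ) ^ 2⌉₊ ≤ k)
    linarith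
  have hMM₁ : M₁ ≤ M := by
    have : (M₁ : ℝ) ≤ M := le_of_sq_le_sq (hkθ.trans hMsq) (by positivity)
    exact_mod_cast this
  have hM16 : 16 * d ≤ M := (le_max_right _ _).trans hMM₁
  have hM2 : (2 : ℝ) ≤ M := by exact_mod_cast (by omega : 2 ≤ M)
  have hMpos : (0 : ℝ) < M := by linarith
  have hkM : θ / 4 * (M : ℝ) ^ 2 ≤ k := by
    have h1 : (M : ℝ) / 2 ≤ Real.sqrt (k / θ) := by linarith
    have h2 : ((M : ℝ) / 2) ^ 2 ≤ k / θ := by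
      rw [← Real.sq_sqrt (by positivity : 0 ≤ (k : ℝ) / θ)]
      gcongr
    rw [le_div_iff₀ hθ0] at h2
    linarith
  set t : ℝ := θ * (k : ℝ) ^ (d - 1) with ht
  have ht0 : 0 ≤ t := by positivity
  have hexp : c * (M : ℝ) ^ (2 * (d - 1)) ≤
      t ^ 2 / ((2 * d * (d * 3 + 1) * (k : ℝ) ^ (d - 1) + r) / 2) := by
    have hkpos : (0 : ℝ) < (k : ℝ) ^ (d - 1) := by positivity
    calc c * (M : ℝ) ^ (2 * (d - 1)) = 2 * θ ^ 2 / β * (θ / 4 * (M : ℝ) ^ 2) ^ (d - 1) := by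
          rw [hc, mul_pow, pow_mul]; ring
      _ ≤ 2 * θ ^ 2 / β * (k : ℝ) ^ (d - 1) := by gcongr
      _ = t ^ 2 / (β * (k : ℝ) ^ (d - 1) / 2) := by rw [ht]; field_simp
      _ ≤ _ := by
          gcongr
          rw [hβ, add_mul]
          gcongr
  have hlt := hM₀ M ((le_max_left _ _).trans hMM₁)
  have hbound := minimalIsotropicDiscrepancy_le hd0 hk r (M := M)
    (hM16.trans (Nat.le_self_pow two_ne_zero M)) ht0 (lt_of_le_of_lt (by
      gcongr
      rw [neg_div]
      exact neg_le_neg hexp) hlt)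
  refine hbound.trans ?_
  have h1 : t / (k ^ d + r : ℕ) ≤ θ / k := by
    push_cast
    rw [div_le_div_iff₀ (by positivity) hk']
    have : (k : ℝ) ^ (d - 1) * k = (k : ℝ) ^ d := by rw [← pow_succ, Nat.sub_add_cancel hd0]
    have hr0 : (0 : ℝ) ≤ r := by positivity
    rw [ht, mul_assoc, this]
    gcongr
    linarith
  have h2 : Cd / (M : ℝ) ^ 2 ≤ Cd * θ / k := by
    rw [div_le_div_iff₀ (by positivity) hk']
    rw [div_le_iff₀ hθ0] at hMsq
    nlinarith
  have h3 : ((k ^ d + r : ℕ) : ℝ) ^ (1 / (d : ℝ)) ≤ 2 * k := by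
    have h4 : ((k ^ d + r : ℕ) : ℝ) ≤ ((k : ℝ) + 1) ^ d := by exact_mod_cast hnk.le
    calc ((k ^ d + r : ℕ) : ℝ) ^ (1 / (d : ℝ)) ≤ (((k : ℝ) + 1) ^ d) ^ (1 / (d : ℝ)) := by
          gcongr
      _ = k + 1 := by
          rw [one_div, Real.pow_rpow_inv_natCast (by positivity) hd0.ne']
      _ ≤ 2 * k := by
          have : (1 : ℝ) ≤ k := by exact_mod_cast hk
          linarith
  have h5 : (0 : ℝ) < ((k ^ d + r : ℕ) : ℝ) ^ (1 / (d : ℝ)) := by positivity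
  calc t / (k ^ d + r : ℕ) + Cd / (M : ℝ) ^ 2 ≤ θ / k + Cd * θ / k := by gcongr
    _ = ε / (2 * k) := by rw [hθ]; field_simp
    _ ≤ _ := by gcongr

theorem exists_mul_minimalIsotropicDiscrepancy_lt {d : ℕ} (hd : 2 ≤ d) (C : ℝ) :
    ∃ N : ℕ, ∀ n, N ≤ n → ∀ L : Submodule ℤ (EuclideanSpace ℝ (Fin d)),
      IsIntegrationLattice L → (latticePointSet L).encard = (n : ℕ∞) →
        C * minimalIsotropicDiscrepancy d n < isotropicDiscrepancy (latticePointSet L) := by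
  set κ : ℝ := Real.sqrt Real.pi / (2 * Real.sqrt (d : ℝ) + 1)
    * Real.Gamma ((d : ℝ) / 2 + 1) ^ (-(1 / (d : ℝ))) with hκ
  have hκ0 : 0 < κ := by
    have : 0 < Real.Gamma ((d : ℝ) / 2 + 1) := Real.Gamma_pos_of_pos (by positivity)
    have := Real.sqrt_pos.2 Real.pi_pos
    positivity
  obtain ⟨N, hN⟩ := exists_minimalIsotropicDiscrepancy_le hd
    (ε := κ / (2 * (|C| + 1))) (by positivity)
  refine ⟨max N 1, fun n hn L hL hcard => ?_⟩
  have hn0 : 0 < n := (le_max_right N 1).trans hn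
  have hn' : (0 : ℝ) < (n : ℝ) ^ (1 / (d : ℝ)) := by positivity
  refine lt_of_lt_of_le ?_ (isotropicDiscrepancy_lower_bound hd hL hcard)
  have h1 := hN n ((le_max_left N 1).trans hn)
  have h2 := minimalIsotropicDiscrepancy_nonneg d n
  calc C * minimalIsotropicDiscrepancy d n ≤ (|C| + 1) * minimalIsotropicDiscrepancy d n := by
        gcongr
        linarith [le_abs_self C]
    _ ≤ (|C| + 1) * (κ / (2 * (|C| + 1)) / (n : ℝ) ^ (1 / (d : ℝ))) := by gcongr
    _ = κ / (n : ℝ) ^ (1 / (d : ℝ)) / 2 := by field_simp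
    _ < κ / (n : ℝ) ^ (1 / (d : ℝ)) := half_lt_self (by positivity)

end Asymptotics

/-! ### Fibonacci point sets as lattice point sets -/

section Fibonacci

/-- The lattice generating the Fibonacci point set. -/
noncomputable def fibonacciLattice (m : ℕ) : Submodule ℤ (EuclideanSpace ℝ (Fin 2)) :=
  Submodule.span ℤ (Set.range
    ![!₂[1 / (Nat.fib m : ℝ), (Nat.fib (m - 1) : ℝ) / (Nat.fib m : ℝ)], !₂[(0 : ℝ), 1]])

theorem mem_fibonacciLattice (m : ℕ) (x : EuclideanSpace ℝ (Fin 2)) :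
    x ∈ fibonacciLattice m ↔ ∃ i j : ℤ, x = !₂[(i : ℝ) / (Nat.fib m : ℝ),
      (i : ℝ) * (Nat.fib (m - 1) : ℝ) / (Nat.fib m : ℝ) + j] := by
  rw [fibonacciLattice, Matrix.range_cons, Matrix.range_cons, Matrix.range_empty, Set.union_empty,
    Set.singleton_union, Submodule.mem_span_pair]
  refine exists_congr fun i => exists_congr fun j => ?_
  rw [eq_comm]
  refine Eq.congr_right ?_
  ext l
  fin_cases l
  · simp [div_eq_mul_inv]
  · simp [mul_div_assoc]

theorem isIntegrationLattice_fibonacciLattice {m : ℕ} (hm : 0 < m) :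
    IsIntegrationLattice (fibonacciLattice m) where
  exists_basis := by
    refine ⟨_, ?_, rfl⟩
    have hF : (Nat.fib m : ℝ) ≠ 0 := by exact_mod_cast (Nat.fib_pos.2 hm).ne'
    rw [LinearIndependent.pair_iff]
    intro s t hst
    have h0 := congrArg (fun x : EuclideanSpace ℝ (Fin 2) => x 0) hst
    have h1 := congrArg (fun x : EuclideanSpace ℝ (Fin 2) => x 1) hst
    simp [hF] at h0 h1
    subst h0
    simpa using h1
  int_mem := by
    intro x hx
    have hF : (Nat.fib m : ℝ) ≠ 0 := by exact_mod_cast (Nat.fib_pos.2 hm).ne'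
    obtain ⟨a, ha⟩ := hx 0
    obtain ⟨b, hb⟩ := hx 1
    refine (mem_fibonacciLattice m x).2 ⟨Nat.fib m * a, b - a * Nat.fib (m - 1), ?_⟩
    ext l
    fin_cases l
    · simp [ha, hF]
    · simp [hb]
      field_simp
      ring

theorem latticePointSet_fibonacciLattice {m : ℕ} (hm : 0 < m) :
    latticePointSet (fibonacciLattice m) = fibonacciPointSet m := by
  have hF : (0 : ℝ) < (Nat.fib m : ℝ) := by exact_mod_cast Nat.fib_pos.2 hm
  ext x
  constructor
  · rintro ⟨hx, hxc⟩
    obtain ⟨i, j, rfl⟩ := (mem_fibonacciLattice m x).1 hx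
    have h0 := hxc 0
    have h1 := hxc 1
    simp only [Matrix.cons_val_zero, Matrix.cons_val_one, Set.mem_Ico,
      div_lt_one hF, le_div_iff₀ hF, zero_mul] at h0 h1
    have hi0 : 0 ≤ i := by exact_mod_cast h0.1
    lift i to ℕ using hi0
    refine ⟨i, by exact_mod_cast h0.2, ?_⟩
    have hfr : (((i : ℕ) : ℤ) : ℝ) * (Nat.fib (m - 1) : ℝ) / (Nat.fib m : ℝ) + j =
        Int.fract ((i : ℝ) * (Nat.fib (m - 1) : ℝ) / (Nat.fib m : ℝ)) := by
      rw [eq_comm, Int.fract_eq_iff]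
      refine ⟨h1.1, h1.2, -j, ?_⟩
      push_cast
      ring
    rw [hfr]
    simp
  · rintro ⟨i, hi, rfl⟩
    refine ⟨(mem_fibonacciLattice m _).2
      ⟨i, -⌊(i : ℝ) * (Nat.fib (m - 1) : ℝ) / (Nat.fib m : ℝ)⌋, ?_⟩, fun l => ?_⟩
    · simp [Int.fract, sub_eq_add_neg]
    · have hi' : (i : ℝ) < Nat.fib m := by exact_mod_cast hi
      fin_cases l
      · exact ⟨div_nonneg (Nat.cast_nonneg i) hF.le, (div_lt_one hF).2 hi'⟩
      · exact ⟨Int.fract_nonneg _, Int.fract_lt_one _⟩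

theorem encard_fibonacciPointSet {m : ℕ} (hm : 0 < m) :
    (fibonacciPointSet m).encard = (Nat.fib m : ℕ∞) := by
  have hF : (Nat.fib m : ℝ) ≠ 0 := by exact_mod_cast (Nat.fib_pos.2 hm).ne'
  have h : fibonacciPointSet m = (fun i : ℕ => (!₂[(i : ℝ) / (Nat.fib m : ℝ),
      Int.fract ((i : ℝ) * (Nat.fib (m - 1) : ℝ) / (Nat.fib m : ℝ))] :
        EuclideanSpace ℝ (Fin 2))) '' (Finset.range (Nat.fib m) : Set ℕ) := by
    ext x
    simp [fibonacciPointSet, eq_comm]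
  rw [h, Function.Injective.encard_image, Set.encard_coe_eq_coe_finsetCard, Finset.card_range]
  intro i j hij
  have h0 := congrArg (fun x : EuclideanSpace ℝ (Fin 2) => x 0) hij
  simpa [div_left_inj' hF] using h0

theorem exists_mul_minimalIsotropicDiscrepancy_lt_fibonacci (C : ℝ) :
    ∃ M : ℕ, ∀ m, M ≤ m → C * minimalIsotropicDiscrepancy 2 (Nat.fib m) <
      isotropicDiscrepancy (fibonacciPointSet m) := by
  obtain ⟨N, hN⟩ := exists_mul_minimalIsotropicDiscrepancy_lt le_rfl C
  -- From index `5` on, `m ≤ Nat.fib m`, so a threshold for `n` serves as one for `m`.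
  refine ⟨max N 5, fun m hm => ?_⟩
  have hm5 : 5 ≤ m := (le_max_right N 5).trans hm
  have hm0 : 0 < m := by omega
  have hle : N ≤ Nat.fib m := ((le_max_left N 5).trans hm).trans (Nat.le_fib_self hm5)
  rw [← latticePointSet_fibonacciLattice hm0]
  refine hN _ hle _ (isIntegrationLattice_fibonacciLattice hm0) ?_
  rw [latticePointSet_fibonacciLattice hm0, encard_fibonacciPointSet hm0]

end Fibonacci

/-! ### Assembly: in both minima the second term alone is already a lower bound -/

theorem mainTheorem5 :
    -- the lower bounds on the spectral test and on the isotropic discrepancy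
    (∀ (d : ℕ), 2 ≤ d → ∀ (L : Submodule ℤ (EuclideanSpace ℝ (Fin d))),
      IsIntegrationLattice L → ∀ (n : ℕ), (latticePointSet L).encard = (n : ℕ∞) →
        Real.sqrt Real.pi / 2 * Real.Gamma ((d : ℝ) / 2 + 1) ^ (-(1 / (d : ℝ)))
            * (1 / (n : ℝ) ^ (1 / (d : ℝ))) ≤ spectralTest L ∧
        min (1 / (2 * Real.sqrt (d : ℝ) + 1))
            ((Real.sqrt Real.pi / (2 * Real.sqrt (d : ℝ) + 1)
                * Real.Gamma ((d : ℝ) / 2 + 1) ^ (-(1 / (d : ℝ)))) / (n : ℝ) ^ (1 / (d : ℝ)))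
          ≤ isotropicDiscrepancy (latticePointSet L)) ∧
    -- the improved constant for spectral test at most one half
    (∃ c : ℝ, 0 < c ∧ ∀ (d : ℕ), 2 ≤ d → ∀ (L : Submodule ℤ (EuclideanSpace ℝ (Fin d))),
      IsIntegrationLattice L → ∀ (n : ℕ), (latticePointSet L).encard = (n : ℕ∞) →
        spectralTest L ≤ 1 / 2 →
        min (1 / (2 * Real.sqrt (d : ℝ) + 1))
            ((c * Real.Gamma ((d : ℝ) / 2 + 1) ^ (-(1 / (d : ℝ)))) / (n : ℝ) ^ (1 / (d : ℝ)))
          ≤ isotropicDiscrepancy (latticePointSet L)) ∧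
    -- lattice point sets are suboptimal for the isotropic discrepancy
    (∀ (d : ℕ), 2 ≤ d → ∀ (C : ℝ), ∃ N : ℕ, ∀ (n : ℕ), N ≤ n →
      ∀ (L : Submodule ℤ (EuclideanSpace ℝ (Fin d))), IsIntegrationLattice L →
        (latticePointSet L).encard = (n : ℕ∞) →
        C * minimalIsotropicDiscrepancy d n < isotropicDiscrepancy (latticePointSet L)) ∧
    -- in particular, Fibonacci lattices do not attain the optimal rate
    (∀ (C : ℝ), ∃ M : ℕ, ∀ (m : ℕ), M ≤ m →
      C * minimalIsotropicDiscrepancy 2 (Nat.fib m)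
        < isotropicDiscrepancy (fibonacciPointSet m)) := by
  refine ⟨fun d hd L hL n hn => ⟨spectralTest_lower_bound hd hL hn,
      (min_le_right _ _).trans (isotropicDiscrepancy_lower_bound hd hL hn)⟩,
    ⟨3 / 32 * Real.sqrt Real.pi, by have := Real.sqrt_pos.2 Real.pi_pos; positivity,
      fun d hd L hL n hn _ =>
        (min_le_right _ _).trans (isotropicDiscrepancy_lower_bound_uniform hd hL hn)⟩,
    fun d hd C => exists_mul_minimalIsotropicDiscrepancy_lt hd C,
    exists_mul_minimalIsotropicDiscrepancy_lt_fibonacci⟩
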